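/- Let $K$ be a field that has an element $\mathrm{i}$ of multiplicative order $4$, and assume that $K$ is not the field $\mathbb{F}_5$ with five elements. Let $G$ be the Pauli group, that is, the subgroup of $\mathrm{GL}_2(K)$ generated by the matrices $$\begin{bmatrix} 0 & 1 \\ 1 & 0 \end{bmatrix},\qquad \begin{bmatrix} 0 & -\mathrm{i} \\ \mathrm{i} & 0 \end{bmatrix},\qquad \begin{bmatrix} 1 & 0 \\ 0 & -1 \end{bmatrix}.$$ Then $\beta_{\mathrm{sep}}^K(G)=7$. Here, for a finite group $G$ and a finite dimensional $K$-linear representation $V$ of $G$, $\beta_{\mathrm{sep}}(G,V)$ is the minimal $d\in\mathbb{N}_0$ such that any two points $v,w\in V$ with $f(v)=f(w)$ for all $G$-invariant polynomials $f\in K[V]^G$ of degree at most $d$ lie in the same $G$-orbit, and $\beta_{\mathrm{sep}}^K(G)$, the separating Noether number of $G$ over $K$, is the supremum of $\beta_{\mathrm{sep}}(G,V)$ over all finite dimensional $K$-linear representations $V$ of $G$. -/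

import Mathlib

open scoped MatrixGroups

/-- The action of `g` on the coordinate ring `K[V] = K[x_1, …, x_n]` of the `K G`-module `V = K^n`
given by the matrix representation `ψ`:
`g · x_j = ∑ i, ψ(g⁻¹)_{j i} x_i`, extended to a `K`-algebra endomorphism. -/
noncomputable def coordAct {K G : Type*} [Field K] [Group G] {n : ℕ}
    (ψ : G →* GL (Fin n) K) (g : G) :
    MvPolynomial (Fin n) K →ₐ[K] MvPolynomial (Fin n) K :=
  MvPolynomial.aeval fun j =>
    ∑ i, MvPolynomial.C ((ψ g⁻¹ : Matrix (Fin n) (Fin n) K) j i) * MvPolynomial.X i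

/-- The algebra `K[V]^G` of polynomial invariants. -/
noncomputable def polyInvariants {K G : Type*} [Field K] [Group G] {n : ℕ}
    (ψ : G →* GL (Fin n) K) : Subalgebra K (MvPolynomial (Fin n) K) :=
  ⨅ g : G, AlgHom.equalizer (coordAct ψ g) (AlgHom.id K (MvPolynomial (Fin n) K))

/-- The set `K[V]^G_{≤ d}` of invariants of degree at most `d` (the zero polynomial included). -/
def polyInvariantsLE {K G : Type*} [Field K] [Group G] {n : ℕ}
    (ψ : G →* GL (Fin n) K) (d : ℕ) : Set (MvPolynomial (Fin n) K) :=
  {f | f ∈ polyInvariants ψ ∧ f.totalDegree ≤ d}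

/-- A set `S` of invariants is separating if any two points `v, w` of `V = K^n` on which
all elements of `S` agree lie in the same `G`-orbit. -/
def IsSeparatingSet {K G : Type*} [Field K] [Group G] {n : ℕ}
    (ψ : G →* GL (Fin n) K) (S : Set (MvPolynomial (Fin n) K)) : Prop :=
  S ⊆ (polyInvariants ψ : Set (MvPolynomial (Fin n) K)) ∧
    ∀ v w : Fin n → K,
      (∀ f ∈ S, MvPolynomial.eval v f = MvPolynomial.eval w f) →
        ∃ g : G, (ψ g : Matrix (Fin n) (Fin n) K).mulVec v = w

/-- `β_sep(G, V)`: the least `d` such that the invariants of degree at most `d` form a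
separating set (with value `⊤` if there is no such `d`). -/
noncomputable def betaSepRep {K G : Type*} [Field K] [Group G] {n : ℕ}
    (ψ : G →* GL (Fin n) K) : ℕ∞ :=
  ⨅ (d : ℕ) (_ : IsSeparatingSet ψ (polyInvariantsLE ψ d)), (d : ℕ∞)

/-- The separating Noether number `β_sep^K(G)`: the supremum of `β_sep(G, V)` over all finite
dimensional `K G`-modules `V`. Choosing a basis of `V`, one may let `V` run over the modules `K^n`
given by the homomorphisms `G → GL_n(K)`. -/
noncomputable def betaSep (K G : Type*) [Field K] [Group G] : ℕ∞ :=
  ⨆ (n : ℕ) (ψ : G →* GL (Fin n) K), betaSepRep ψ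

/-- The Pauli group: the subgroup of `GL_2(K)` generated by the three Pauli matrices, where `i` is
an element of `K` of multiplicative order `4` (so that all three matrices are invertible). -/
def pauliGroup {K : Type*} [Field K] (i : K) : Subgroup (GL (Fin 2) K) :=
  Subgroup.closure
    {g | (g : Matrix (Fin 2) (Fin 2) K) = !![0, 1; 1, 0] ∨
      (g : Matrix (Fin 2) (Fin 2) K) = !![0, -i; i, 0] ∨
      (g : Matrix (Fin 2) (Fin 2) K) = !![1, 0; 0, -1]}

/-!
The Pauli group `G` has order 16. It is generated by reflections, its abelianization is `(ℤ/2) ^ 3`,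
and its irreducible representations over `K` are eight characters with values `±1` (`pauliChar`),
the natural representation `ρ` on `K ^ 2`, and the twist of `ρ` by the determinant.

Upper bound (`isSeparatingSet_seven`). Let `v`, `w` be points of a representation `V` that the
invariants of degree at most seven do not separate. By averaging, `v` and `w` agree on all invariant
polynomial functions of degree at most seven. The point `w` is compared with `v` through linear
equivariant maps from `V` to the irreducible representations, which separate points
(`eq_of_equivariant`). Three quadratic forms on `K ^ 2` (`pauliForm`, namely `x ^ 2 + y ^ 2`,
`x ^ 2 - y ^ 2`, `2 x y`) are semi-invariants whose weights form a basis of the group of characters;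
their product vanishes exactly on the six lines fixed by reflections.

* If some equivariant map `φ : V → K ^ 2` has `φ v ≠ 0`, then the degree four invariants of `K ^ 2`
  allow to move `v` so that `φ v = φ w = p`. Any semi-invariant can be made invariant by multiplying
  it by those of the three forms that its weight requires, and these factors can be cancelled
  where they do not vanish at `p`. If `p` lies on none of the six lines, then all components of `v`
  and `w` agree and `w = v` (`eq_of_forms_ne_zero`); the degree seven is needed for the component of
  weight `det`, which requires all three forms. If `p` lies on the line of a reflection `s`, then an
  automorphism of `G` makes `s` diagonal, the `s`-fixed components and all products of two
  `s`-negated components agree, and `w = v` or `w = s v` (`exists_mulVec_eq_of_axis`).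
* Otherwise only `(ℤ/2) ^ 3` acts, and relations between at most four of its characters suffice
  (`exists_linearMap_eqOn`).

Lower bound (`not_isSeparatingSet_six`). On `K ^ 2 ⊕ det`, with coordinates `x, y, t`, the invariants
of degree at most six are even in `t`, so they do not separate `(x, y, t)` from `(x, y, -t)`. These
points lie in different orbits if `t ≠ 0` and `(x, y)` lies on none of the six lines. Such a vector
`(1, y)` exists unless all nonzero elements of `K` are fourth roots of unity, that is, unless
`K = 𝔽₅`.
-/

/-! ### Invariant polynomials and invariant polynomial functions -/

section Averaging

variable {K G : Type*} [Field K] [Group G] {n : ℕ}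

/-- `F` is the function on `K^n` of some polynomial of degree at most `d`. Invariance of such a
function is weaker than invariance of the polynomial when `K` is finite; averaging over the group
(`eq_of_invariant`) bridges the gap. -/
def IsPolyFun (d : ℕ) (F : (Fin n → K) → K) : Prop :=
  ∃ f : MvPolynomial (Fin n) K, f.totalDegree ≤ d ∧ ∀ u, MvPolynomial.eval u f = F u

namespace IsPolyFun

variable {d d' : ℕ} {F F' : (Fin n → K) → K}

lemma mono (h : IsPolyFun d F) (hd : d ≤ d') : IsPolyFun d' F := by
  obtain ⟨f, hf, hF⟩ := h
  exact ⟨f, hf.trans hd, hF⟩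

lemma one : IsPolyFun 0 (fun _ : Fin n → K => (1 : K)) := ⟨1, by simp, by simp⟩

lemma add (h : IsPolyFun d F) (h' : IsPolyFun d F') : IsPolyFun d (fun u => F u + F' u) := by
  obtain ⟨f, hf, hF⟩ := h
  obtain ⟨f', hf', hF'⟩ := h'
  exact ⟨f + f', (MvPolynomial.totalDegree_add _ _).trans (max_le hf hf'), by simp [hF, hF']⟩

lemma sub (h : IsPolyFun d F) (h' : IsPolyFun d F') : IsPolyFun d (fun u => F u - F' u) := by
  obtain ⟨f, hf, hF⟩ := h
  obtain ⟨f', hf', hF'⟩ := h'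
  exact ⟨f - f', (MvPolynomial.totalDegree_sub _ _).trans (max_le hf hf'), by simp [hF, hF']⟩

lemma mul (h : IsPolyFun d F) (h' : IsPolyFun d' F') :
    IsPolyFun (d + d') (fun u => F u * F' u) := by
  obtain ⟨f, hf, hF⟩ := h
  obtain ⟨f', hf', hF'⟩ := h'
  exact ⟨f * f', (MvPolynomial.totalDegree_mul _ _).trans (add_le_add hf hf'), by simp [hF, hF']⟩

lemma linear (l : (Fin n → K) →ₗ[K] K) : IsPolyFun 1 l := by
  refine ⟨∑ j, MvPolynomial.C (l (Pi.single j 1)) * MvPolynomial.X j, ?_, fun u => ?_⟩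
  · refine MvPolynomial.totalDegree_finsetSum_le fun j _ => ?_
    exact (MvPolynomial.totalDegree_mul _ _).trans (by simp)
  · rw [LinearMap.pi_apply_eq_sum_univ l u]
    simp only [map_sum, map_mul, MvPolynomial.eval_C, MvPolynomial.eval_X, smul_eq_mul]
    refine Finset.sum_congr rfl fun j _ => ?_
    rw [mul_comm]
    congr 2
    ext k
    simp [Pi.single_apply, eq_comm]

end IsPolyFun

lemma eval_coordAct (ψ : G →* GL (Fin n) K) (g : G) (f : MvPolynomial (Fin n) K)
    (u : Fin n → K) :
    MvPolynomial.eval u (coordAct ψ g f) =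
      MvPolynomial.eval ((ψ g⁻¹ : Matrix (Fin n) (Fin n) K).mulVec u) f := by
  induction f using MvPolynomial.induction_on with
  | C a => simp [coordAct]
  | add p q hp hq => simp [hp, hq]
  | mul_X p j hp => simp only [map_mul, hp]; simp [coordAct, Matrix.mulVec, dotProduct]

lemma coordAct_coordAct (ψ : G →* GL (Fin n) K) (h g : G) (f : MvPolynomial (Fin n) K) :
    coordAct ψ h (coordAct ψ g f) = coordAct ψ (h * g) f := by
  have hX (g : G) (j : Fin n) : coordAct ψ g (MvPolynomial.X j) =
      ∑ i, MvPolynomial.C ((ψ g⁻¹ : Matrix (Fin n) (Fin n) K) j i) * MvPolynomial.X i :=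
    MvPolynomial.aeval_X _ _
  have hC (g : G) (a : K) : coordAct ψ g (MvPolynomial.C a) = MvPolynomial.C a :=
    MvPolynomial.algHom_C _ _
  induction f using MvPolynomial.induction_on with
  | C a => rw [hC, hC, hC]
  | add p q hp hq => rw [map_add, map_add, map_add, hp, hq]
  | mul_X p j hp =>
    rw [map_mul, map_mul, map_mul, hp, hX, hX, map_sum]
    congr 1
    simp only [map_mul (coordAct ψ h), hC, hX, mul_inv_rev, map_mul ψ, Units.val_mul,
      Matrix.mul_apply, map_sum MvPolynomial.C, map_mul MvPolynomial.C, Finset.mul_sum,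
      Finset.sum_mul]
    rw [Finset.sum_comm]
    simp only [mul_assoc]

lemma totalDegree_coordAct_le (ψ : G →* GL (Fin n) K) (g : G) (f : MvPolynomial (Fin n) K) :
    (coordAct ψ g f).totalDegree ≤ f.totalDegree := by
  have hlin (j : Fin n) : (∑ i, MvPolynomial.C ((ψ g⁻¹ : Matrix (Fin n) (Fin n) K) j i) *
      (MvPolynomial.X i : MvPolynomial (Fin n) K)).totalDegree ≤ 1 :=
    MvPolynomial.totalDegree_finsetSum_le fun i _ =>
      (MvPolynomial.totalDegree_mul _ _).trans (by simp)
  rw [coordAct, MvPolynomial.aeval_def, MvPolynomial.eval₂_eq]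
  refine MvPolynomial.totalDegree_finsetSum_le fun m hm => ?_
  refine (MvPolynomial.totalDegree_mul _ _).trans ?_
  rw [MvPolynomial.algebraMap_eq, MvPolynomial.totalDegree_C, zero_add]
  refine (MvPolynomial.totalDegree_finsetProd _ _).trans ?_
  refine le_trans ?_ (MvPolynomial.le_totalDegree hm)
  rw [Finsupp.sum]
  refine Finset.sum_le_sum fun j _ => (MvPolynomial.totalDegree_pow _ _).trans ?_
  exact (Nat.mul_le_mul_left _ (hlin j)).trans (by simp)

lemma mem_polyInvariants_iff {ψ : G →* GL (Fin n) K} {f : MvPolynomial (Fin n) K} :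
    f ∈ polyInvariants ψ ↔ ∀ g, coordAct ψ g f = f := by
  simp [polyInvariants, Algebra.mem_iInf, AlgHom.mem_equalizer]

/-- Points that the invariant polynomials of degree at most `d` do not distinguish are not
distinguished by invariant polynomial functions of degree at most `d` either, provided that `|G|`
is invertible in `K`: average a polynomial that represents the function. -/
lemma eq_of_invariant [Finite G] (hG : (Nat.card G : K) ≠ 0) {ψ : G →* GL (Fin n) K} {d : ℕ}
    {v w : Fin n → K}
    (hvw : ∀ f ∈ polyInvariantsLE ψ d, MvPolynomial.eval v f = MvPolynomial.eval w f)
    {F : (Fin n → K) → K} (hF : IsPolyFun d F)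
    (hinv : ∀ g u, F ((ψ g : Matrix (Fin n) (Fin n) K).mulVec u) = F u) : F v = F w := by
  classical
  have := Fintype.ofFinite G
  obtain ⟨f, hfd, hf⟩ := hF
  have hmem : ∑ g, coordAct ψ g f ∈ polyInvariantsLE ψ d := by
    refine ⟨mem_polyInvariants_iff.2 fun h => ?_, ?_⟩
    · simp only [map_sum, coordAct_coordAct]
      exact Fintype.sum_equiv (Equiv.mulLeft h) _ _ fun g => rfl
    · exact MvPolynomial.totalDegree_finsetSum_le fun g _ =>
        (totalDegree_coordAct_le ψ g f).trans hfd
  have key (u : Fin n → K) :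
      MvPolynomial.eval u (∑ g, coordAct ψ g f) = (Nat.card G : K) * F u := by
    simp only [map_sum, eval_coordAct, hf, hinv]
    simp
  have := hvw _ hmem
  rw [key, key] at this
  exact mul_left_cancel₀ hG this

end Averaging

/-! ### Pauli matrices -/

section Pauli

variable {K : Type*} [Field K]

/-- The elements of the Pauli group, as matrices: the matrices `z I`, `z Z`, `z X`, `z X Z` up to
sign, where `X`, `Z` are the first and third Pauli matrix and `z ^ 4 = 1`. -/
def IsPauli (N : Matrix (Fin 2) (Fin 2) K) : Prop :=
  ∃ z : K, z ^ 4 = 1 ∧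
    (N = !![z, 0; 0, z] ∨ N = !![z, 0; 0, -z] ∨ N = !![0, z; z, 0] ∨ N = !![0, z; -z, 0])

/-- Three bilinear forms on `K ^ 2`, each of which a Pauli matrix multiplies by a sign. Together
with the determinant form they span all bilinear forms. -/
def pauliForm (j : Fin 3) (a b : Fin 2 → K) : K :=
  ![a 0 * b 0 + a 1 * b 1, a 0 * b 0 - a 1 * b 1, a 0 * b 1 + a 1 * b 0] j

/-- The determinant form on `K ^ 2`. -/
def detForm (a b : Fin 2 → K) : K := a 0 * b 1 - a 1 * b 0

/-- The sign by which a Pauli matrix multiplies `pauliForm j`. -/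
def pauliSign (j : Fin 3) (N : Matrix (Fin 2) (Fin 2) K) : K :=
  ![N 0 0 ^ 2 + N 1 0 ^ 2, N 0 0 ^ 2 - N 1 0 ^ 2, N 0 0 * N 1 1 + N 0 1 * N 1 0] j

/-- The character of the Pauli group with exponents `e`; the signs `pauliSign 0`, `pauliSign 1`,
`pauliSign 2` form a basis of the group of characters. -/
def pauliChar (e : Fin 3 → ZMod 2) (N : Matrix (Fin 2) (Fin 2) K) : K :=
  ∏ j, pauliSign j N ^ (e j).val

lemma IsPauli.form_mulVec {N : Matrix (Fin 2) (Fin 2) K} (hN : IsPauli N) (j : Fin 3)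
    (a b : Fin 2 → K) :
    pauliForm j (N.mulVec a) (N.mulVec b) = pauliSign j N * pauliForm j a b := by
  obtain ⟨z, -, rfl | rfl | rfl | rfl⟩ := hN <;> fin_cases j <;>
    simp [pauliForm, pauliSign, Matrix.mulVec, dotProduct, Fin.sum_univ_two] <;> ring

lemma detForm_mulVec (N : Matrix (Fin 2) (Fin 2) K) (a b : Fin 2 → K) :
    detForm (N.mulVec a) (N.mulVec b) = N.det * detForm a b := by
  simp only [detForm, Matrix.mulVec, dotProduct, Fin.sum_univ_two, Matrix.det_fin_two]
  ring

lemma IsPauli.sign_mul_self {N : Matrix (Fin 2) (Fin 2) K} (hN : IsPauli N) (j : Fin 3) :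
    pauliSign j N * pauliSign j N = 1 := by
  obtain ⟨z, hz, rfl | rfl | rfl | rfl⟩ := hN <;> fin_cases j <;>
    simp [pauliSign] <;> linear_combination hz

lemma IsPauli.sign_mul {M N : Matrix (Fin 2) (Fin 2) K} (hM : IsPauli M) (hN : IsPauli N)
    (j : Fin 3) : pauliSign j (M * N) = pauliSign j M * pauliSign j N := by
  obtain ⟨y, -, rfl | rfl | rfl | rfl⟩ := hM <;> obtain ⟨z, -, rfl | rfl | rfl | rfl⟩ := hN <;>
    fin_cases j <;> simp [pauliSign] <;> ring

lemma IsPauli.char_add {N : Matrix (Fin 2) (Fin 2) K} (hN : IsPauli N) (e e' : Fin 3 → ZMod 2) :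
    pauliChar (e + e') N = pauliChar e N * pauliChar e' N := by
  have key (a b : ZMod 2) (s : K) (hs : s * s = 1) :
      s ^ (a + b).val = s ^ a.val * s ^ b.val := by
    have h2 : (1 + 1 : ZMod 2) = 0 := rfl
    have h01 : ∀ a : ZMod 2, a = 0 ∨ a = 1 := by decide
    obtain rfl | rfl := h01 a <;> obtain rfl | rfl := h01 b <;> simp [h2, hs, ZMod.val_one]
  simp only [pauliChar, ← Finset.prod_mul_distrib, Pi.add_apply]
  exact Finset.prod_congr rfl fun j _ => key _ _ _ (hN.sign_mul_self j)

lemma IsPauli.char_mul {M N : Matrix (Fin 2) (Fin 2) K} (hM : IsPauli M) (hN : IsPauli N)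
    (e : Fin 3 → ZMod 2) : pauliChar e (M * N) = pauliChar e M * pauliChar e N := by
  simp only [pauliChar, ← Finset.prod_mul_distrib, hM.sign_mul hN, mul_pow]

lemma pauliChar_zero (N : Matrix (Fin 2) (Fin 2) K) : pauliChar 0 N = 1 := by
  simp [pauliChar]

lemma pauliChar_single (j : Fin 3) (N : Matrix (Fin 2) (Fin 2) K) :
    pauliChar (Pi.single j 1) N = pauliSign j N := by
  fin_cases j <;> simp [pauliChar, Fin.prod_univ_three, Pi.single_apply, ZMod.val_one]

lemma IsPauli.char_one {N : Matrix (Fin 2) (Fin 2) K} (hN : IsPauli N) :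
    pauliChar 1 N = N.det := by
  obtain ⟨z, hz, rfl | rfl | rfl | rfl⟩ := hN <;>
    simp [pauliChar, pauliSign, Fin.prod_univ_three, ZMod.val_one, Matrix.det_fin_two] <;>
    linear_combination (z ^ 2) * hz

lemma IsPauli.det_mul_self {N : Matrix (Fin 2) (Fin 2) K} (hN : IsPauli N) :
    N.det * N.det = 1 := by
  obtain ⟨z, hz, rfl | rfl | rfl | rfl⟩ := hN <;> simp [Matrix.det_fin_two] <;>
    linear_combination hz

lemma IsPauli.pow_four {N : Matrix (Fin 2) (Fin 2) K} (hN : IsPauli N) : N ^ 4 = 1 := by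
  obtain ⟨z, hz, rfl | rfl | rfl | rfl⟩ := hN <;> ext j k <;> fin_cases j <;> fin_cases k <;>
    simp [pow_succ] <;> linear_combination hz

/-- The character of the regular representation of the Pauli group, as the sum of its
irreducible characters with multiplicities. -/
lemma IsPauli.regular_char {N : Matrix (Fin 2) (Fin 2) K} (hN : IsPauli N) (h1 : N ≠ 1) :
    ∑ e, pauliChar e N + 2 * N.trace + 2 * (N.det * N.trace) = 0 := by
  have hsum : ∑ e, pauliChar e N = ∏ j, (1 + pauliSign j N) := by
    have h := Finset.prod_univ_sum (fun _ : Fin 3 => (Finset.univ : Finset (ZMod 2)))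
      (fun j a => pauliSign j N ^ a.val)
    have h2 (s : K) : ∑ a : ZMod 2, s ^ a.val = 1 + s := by
      rw [show (Finset.univ : Finset (ZMod 2)) = {0, 1} from rfl, Finset.sum_pair (by decide)]
      simp [ZMod.val_one]
    simp only [h2] at h
    rw [h, Fintype.piFinset_univ]
    rfl
  rw [hsum, Fin.prod_univ_three]
  obtain ⟨z, hz, rfl | rfl | rfl | rfl⟩ := hN
  · have hz1 : z - 1 ≠ 0 := fun h => h1 (by
      rw [sub_eq_zero.1 h]; ext j k; fin_cases j <;> fin_cases k <;> simp)
    have hz' : (z + 1) * (z ^ 2 + 1) = 0 :=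
      mul_left_cancel₀ hz1 (by linear_combination hz)
    simp [pauliSign, Matrix.det_fin_two, Matrix.trace_fin_two]
    linear_combination (z ^ 3 - z ^ 2 + 3 * z + 1) * hz'
  all_goals
    simp [pauliSign, Matrix.det_fin_two, Matrix.trace_fin_two, -mul_eq_zero]
    first
      | linear_combination (-1 - z ^ 2) * hz
      | linear_combination (-1 + z ^ 2) * hz

lemma regular_char_one :
    ∑ e, pauliChar e (1 : Matrix (Fin 2) (Fin 2) K) + 2 * (1 : Matrix (Fin 2) (Fin 2) K).trace +
      2 * ((1 : Matrix (Fin 2) (Fin 2) K).det * (1 : Matrix (Fin 2) (Fin 2) K).trace) = 16 := by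
  have h (e : Fin 3 → ZMod 2) : pauliChar e (1 : Matrix (Fin 2) (Fin 2) K) = 1 :=
    Finset.prod_eq_one fun j _ => by fin_cases j <;> simp [pauliSign]
  simp only [h]
  simp
  norm_num

/-- Two points at which the basic invariants `x ^ 4 + y ^ 4` and `x ^ 2 * y ^ 2` of the Pauli group
agree lie in the same orbit. -/
lemma exists_isPauli_mulVec (h2 : (2 : K) ≠ 0) {p q : Fin 2 → K}
    (h0 : pauliForm 0 p p * pauliForm 0 p p = pauliForm 0 q q * pauliForm 0 q q)
    (hx : pauliForm 2 p p * pauliForm 2 p p = pauliForm 2 q q * pauliForm 2 q q) :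
    ∃ N : Matrix (Fin 2) (Fin 2) K, IsPauli N ∧ N.mulVec p = q := by
  simp only [pauliForm, Matrix.cons_val] at h0 hx
  have hprod : p 0 ^ 2 * p 1 ^ 2 = q 0 ^ 2 * q 1 ^ 2 :=
    mul_left_cancel₀ (mul_ne_zero h2 h2) (by linear_combination hx)
  have hsum : p 0 ^ 4 + p 1 ^ 4 = q 0 ^ 4 + q 1 ^ 4 := by linear_combination h0 - 2 * hprod
  -- Up to exchanging the coordinates of `p`, those of `q` differ from them by fourth roots of unity.
  have key (x y x' y' : K) (hx : x' ^ 4 = x ^ 4) (hy : y' ^ 4 = y ^ 4)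
      (h : x ^ 2 * y ^ 2 = x' ^ 2 * y' ^ 2) :
      ∃ z : K, z ^ 4 = 1 ∧ x' = z * x ∧ (y' = z * y ∨ y' = -(z * y)) := by
    by_cases hx0 : x = 0
    · subst hx0
      have hx' : x' = 0 := by simpa using hx
      by_cases hy0 : y = 0
      · subst hy0
        have hy' : y' = 0 := by simpa using hy
        exact ⟨1, by simp, by simp [hx'], by simp [hy']⟩
      · refine ⟨y' / y, by rw [div_pow, hy, div_self (pow_ne_zero _ hy0)], by simp [hx'], ?_⟩
        left; field_simp
    · have hz : (x' / x) ^ 4 = 1 := by rw [div_pow, hx, div_self (pow_ne_zero _ hx0)]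
      refine ⟨x' / x, hz, by field_simp, ?_⟩
      apply sq_eq_sq_iff_eq_or_eq_neg.1
      have hxz : x' = x' / x * x := by field_simp
      generalize x' / x = z at *
      subst hxz
      refine mul_left_cancel₀ (pow_ne_zero 2 hx0) ?_
      linear_combination (-z ^ 2) * h - x ^ 2 * y' ^ 2 * hz
  have hroots : (q 0 ^ 4 - p 0 ^ 4) * (q 0 ^ 4 - p 1 ^ 4) = 0 := by
    linear_combination (-(q 0) ^ 4) * hsum + (p 0 ^ 2 * p 1 ^ 2 + q 0 ^ 2 * q 1 ^ 2) * hprod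
  rcases mul_eq_zero.1 hroots with h | h
  · obtain ⟨z, hz, h0, h1 | h1⟩ := key (p 0) (p 1) (q 0) (q 1) (sub_eq_zero.1 h)
      (by linear_combination -hsum - h) hprod
    · exact ⟨_, ⟨z, hz, Or.inl rfl⟩, by
        ext j; fin_cases j <;> simp [Matrix.mulVec, dotProduct, h0, h1]⟩
    · exact ⟨_, ⟨z, hz, Or.inr (Or.inl rfl)⟩, by
        ext j; fin_cases j <;> simp [Matrix.mulVec, dotProduct, h0, h1]⟩
  · obtain ⟨z, hz, h0, h1 | h1⟩ := key (p 1) (p 0) (q 0) (q 1) (sub_eq_zero.1 h)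
      (by linear_combination -hsum - h) (by linear_combination hprod)
    · exact ⟨_, ⟨z, hz, Or.inr (Or.inr (Or.inl rfl))⟩, by
        ext j; fin_cases j <;> simp [Matrix.mulVec, dotProduct, h0, h1]⟩
    · exact ⟨_, ⟨z, hz, Or.inr (Or.inr (Or.inr rfl))⟩, by
        ext j; fin_cases j <;> simp [Matrix.mulVec, dotProduct, h0, h1]⟩

lemma exists_isPauli_sign {i : K} (hi : i ^ 2 = -1) (s : Fin 3 → K)
    (hs : ∀ j, s j = 1 ∨ s j = -1) :
    ∃ N : Matrix (Fin 2) (Fin 2) K, IsPauli N ∧ ∀ j, pauliSign j N = s j := by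
  have hi4 : i ^ 4 = 1 := by linear_combination (i ^ 2 - 1) * hi
  have hz : ∃ z : K, z ^ 4 = 1 ∧ z ^ 2 = s 0 := by
    rcases hs 0 with h | h
    · exact ⟨1, by simp, by simp [h]⟩
    · exact ⟨i, hi4, by rw [hi, h]⟩
  obtain ⟨z, hz, hz2⟩ := hz
  have h3 (N : Matrix (Fin 2) (Fin 2) K) (h0 : pauliSign 0 N = s 0) (h1 : pauliSign 1 N = s 1)
      (h2 : pauliSign 2 N = s 2) : ∀ j, pauliSign j N = s j := by
    intro j; fin_cases j <;> assumption
  have hs1 : s 1 = s 0 ∨ s 1 = -s 0 := by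
    rcases hs 0 with h | h <;> rcases hs 1 with h' | h' <;> simp [h, h']
  have hs2 : s 2 = s 0 ∨ s 2 = -s 0 := by
    rcases hs 0 with h | h <;> rcases hs 2 with h' | h' <;> simp [h, h']
  rcases hs1 with h1 | h1 <;> rcases hs2 with h2 | h2
  · exact ⟨_, ⟨z, hz, Or.inl rfl⟩, h3 _ (by simp [pauliSign, hz2])
      (by simp [pauliSign, hz2, h1]) (by simp [pauliSign, ← hz2, h2, pow_two])⟩
  · exact ⟨_, ⟨z, hz, Or.inr (Or.inl rfl)⟩, h3 _ (by simp [pauliSign, hz2])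
      (by simp [pauliSign, hz2, h1]) (by simp [pauliSign, ← hz2, h2, pow_two])⟩
  · exact ⟨_, ⟨z, hz, Or.inr (Or.inr (Or.inl rfl))⟩, h3 _ (by simp [pauliSign, hz2])
      (by simp [pauliSign, hz2, h1]) (by simp [pauliSign, ← hz2, h2, pow_two])⟩
  · exact ⟨_, ⟨z, hz, Or.inr (Or.inr (Or.inr rfl))⟩, h3 _ (by simp [pauliSign, hz2])
      (by simp [pauliSign, hz2, h1]) (by simp [pauliSign, ← hz2, h2, pow_two])⟩

end Pauli

/-! ### Representations by Pauli matrices and semi-invariant functions -/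

section SemiInvariants

variable {K G : Type*} [Field K] [Group G] {n : ℕ}

/-- `ρ` is a representation of `G` that identifies `G` with the group of Pauli matrices. Working
with an arbitrary such `ρ` allows the natural representation to be twisted by automorphisms. -/
structure IsPauliRep (ρ : G →* Matrix (Fin 2) (Fin 2) K) : Prop where
  isPauli : ∀ g, IsPauli (ρ g)
  surj : ∀ N, IsPauli N → ∃ g, ρ g = N
  inj : Function.Injective ρ

/-- The twist of a two-dimensional representation by its determinant character. For a Pauli
representation this is the second irreducible representation of degree two. -/
def detTwist (ρ : G →* Matrix (Fin 2) (Fin 2) K) : G →* Matrix (Fin 2) (Fin 2) K where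
  toFun g := (ρ g).det • ρ g
  map_one' := by simp
  map_mul' g h := by rw [map_mul, Matrix.det_mul, Matrix.smul_mul, Matrix.mul_smul, smul_smul]

lemma detTwist_apply (ρ : G →* Matrix (Fin 2) (Fin 2) K) (g : G) :
    detTwist ρ g = (ρ g).det • ρ g := rfl

/-- The conjugate of a representation by an invertible matrix `M` with inverse `M'`. -/
def conjRep (ρ : G →* Matrix (Fin 2) (Fin 2) K) (M M' : Matrix (Fin 2) (Fin 2) K)
    (h : M * M' = 1) : G →* Matrix (Fin 2) (Fin 2) K where
  toFun g := M * ρ g * M'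
  map_one' := by simp [h]
  map_mul' g g' := by
    have h' : M' * M = 1 := mul_eq_one_comm.1 h
    calc M * ρ (g * g') * M' = M * ρ g * 1 * ρ g' * M' := by simp [mul_assoc]
      _ = M * ρ g * M' * (M * ρ g' * M') := by simp only [← h', mul_assoc]

lemma conjRep_apply (ρ : G →* Matrix (Fin 2) (Fin 2) K) (M M' : Matrix (Fin 2) (Fin 2) K)
    (h : M * M' = 1) (g : G) : conjRep ρ M M' h g = M * ρ g * M' := rfl

lemma IsPauli.smul {N : Matrix (Fin 2) (Fin 2) K} (hN : IsPauli N) {s : K} (hs : s ^ 4 = 1) :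
    IsPauli (s • N) := by
  obtain ⟨z, hz, h⟩ := hN
  refine ⟨s * z, by rw [mul_pow, hs, hz, one_mul], ?_⟩
  rcases h with rfl | rfl | rfl | rfl <;> simp

lemma IsPauli.det_pow_four {N : Matrix (Fin 2) (Fin 2) K} (hN : IsPauli N) : N.det ^ 4 = 1 := by
  linear_combination (N.det * N.det + 1) * hN.det_mul_self

namespace IsPauliRep

variable {ρ : G →* Matrix (Fin 2) (Fin 2) K}

lemma finite (hρ : IsPauliRep ρ) : Finite G := by
  let S : Set K := {z | z ^ 4 = 1} ∪ {0}
  have hS : S.Finite := by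
    classical
    refine Set.Finite.union ?_ (Set.finite_singleton 0)
    refine (Polynomial.nthRoots 4 (1 : K)).toFinset.finite_toSet.subset fun z hz => ?_
    simpa [Polynomial.mem_nthRoots] using hz
  have hfin : {N : Matrix (Fin 2) (Fin 2) K | ∀ j k, N j k ∈ S}.Finite :=
    Set.Finite.pi' fun _ => Set.Finite.pi' fun _ => hS
  have hneg (z : K) (hz : z ^ 4 = 1) : (-z) ^ 4 = 1 := by rw [← hz]; ring
  refine Set.finite_univ_iff.1 (Set.Finite.of_finite_image (f := ρ) (hfin.subset ?_)
    hρ.inj.injOn)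
  rintro _ ⟨g, -, rfl⟩ j k
  obtain ⟨z, hz, h | h | h | h⟩ := hρ.isPauli g <;> rw [h] <;> fin_cases j <;> fin_cases k <;>
    simp [S, hz, hneg z hz]

lemma card_ne_zero (hρ : IsPauliRep ρ) (h2 : (2 : K) ≠ 0) : (Nat.card G : K) ≠ 0 := by
  have := hρ.finite
  have hp : IsPGroup 2 G := fun g => ⟨2, hρ.inj (by
    rw [map_pow, map_one]; exact (hρ.isPauli g).pow_four)⟩
  obtain ⟨m, hm⟩ := IsPGroup.iff_card.1 hp
  rw [hm, Nat.cast_pow]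
  exact pow_ne_zero _ (by exact_mod_cast h2)

lemma detTwist (hρ : IsPauliRep ρ) : IsPauliRep (detTwist ρ) where
  isPauli g := (hρ.isPauli g).smul (hρ.isPauli g).det_pow_four
  surj N hN := by
    obtain ⟨g, hg⟩ := hρ.surj _ (hN.smul hN.det_pow_four)
    refine ⟨g, ?_⟩
    have h : N.det ^ 3 * N.det = 1 := by rw [← hN.det_pow_four]; ring
    rw [detTwist_apply, hg, Matrix.det_smul, smul_smul]
    simp only [Fintype.card_fin]
    rw [show N.det ^ 2 * N.det * N.det = 1 by rw [← h]; ring, one_smul]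
  inj g h hgh := by
    simp only [detTwist_apply] at hgh
    have hdet (g : G) : ((ρ g).det • ρ g).det = (ρ g).det := by
      rw [Matrix.det_smul, Fintype.card_fin, pow_two, (hρ.isPauli g).det_mul_self, one_mul]
    have hd : (ρ g).det = (ρ h).det := by rw [← hdet g, hgh, hdet h]
    rw [hd] at hgh
    have h0 : (ρ h).det ≠ 0 := left_ne_zero_of_mul_eq_one (hρ.isPauli h).det_mul_self
    exact hρ.inj (smul_right_injective _ h0 hgh)

lemma conjRep (hρ : IsPauliRep ρ) {M M' : Matrix (Fin 2) (Fin 2) K} (h : M * M' = 1)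
    (hM : ∀ N, IsPauli N → IsPauli (M * N * M') ∧ IsPauli (M' * N * M)) :
    IsPauliRep (conjRep ρ M M' h) where
  isPauli g := (hM _ (hρ.isPauli g)).1
  surj N hN := by
    obtain ⟨g, hg⟩ := hρ.surj _ (hM N hN).2
    refine ⟨g, ?_⟩
    rw [conjRep_apply, hg]
    calc M * (M' * N * M) * M' = M * M' * N * (M * M') := by simp only [mul_assoc]
      _ = N := by rw [h, one_mul, mul_one]
  inj g g' hg := by
    have h' : M' * M = 1 := mul_eq_one_comm.1 h
    have key (g : G) : M' * (M * ρ g * M') * M = ρ g := by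
      calc M' * (M * ρ g * M') * M = M' * M * ρ g * (M' * M) := by simp only [mul_assoc]
        _ = ρ g := by rw [h', one_mul, mul_one]
    apply hρ.inj
    rw [← key g, ← key g', ← conjRep_apply ρ M M' h g, hg, conjRep_apply]

end IsPauliRep

/-- The linear map `φ : K^n → K^2` commutes with the actions `ψ` and `ρ` of `G`. -/
def Equivariant (ψ : G →* GL (Fin n) K) (ρ : G →* Matrix (Fin 2) (Fin 2) K)
    (φ : (Fin n → K) →ₗ[K] (Fin 2 → K)) : Prop :=
  ∀ g u, φ ((ψ g : Matrix (Fin n) (Fin n) K).mulVec u) = (ρ g).mulVec (φ u)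

/-- `F` is a polynomial function of degree at most `d` on `K^n` that transforms under `G` by the
character with exponents `e`. -/
structure SemiInv (ψ : G →* GL (Fin n) K) (ρ : G →* Matrix (Fin 2) (Fin 2) K) (d : ℕ)
    (e : Fin 3 → ZMod 2) (F : (Fin n → K) → K) : Prop where
  isPolyFun : IsPolyFun d F
  weight : ∀ g u, F ((ψ g : Matrix (Fin n) (Fin n) K).mulVec u) = pauliChar e (ρ g) * F u

variable {ψ : G →* GL (Fin n) K} {ρ : G →* Matrix (Fin 2) (Fin 2) K}

namespace SemiInv

variable {d d' : ℕ} {e e' : Fin 3 → ZMod 2} {F F' : (Fin n → K) → K}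

lemma one : SemiInv ψ ρ 0 0 (fun _ => 1) :=
  ⟨IsPolyFun.one, fun g u => by simp [pauliChar_zero]⟩

lemma mul (hρ : IsPauliRep ρ) (hF : SemiInv ψ ρ d e F) (hF' : SemiInv ψ ρ d' e' F') :
    SemiInv ψ ρ (d + d') (e + e') (fun u => F u * F' u) :=
  ⟨hF.isPolyFun.mul hF'.isPolyFun, fun g u => by
    simp only [hF.weight, hF'.weight, (hρ.isPauli g).char_add]; ring⟩

lemma prod (hρ : IsPauliRep ρ) {ι : Type*} (T : Finset ι) {d : ι → ℕ}
    {e : ι → Fin 3 → ZMod 2} {F : ι → (Fin n → K) → K}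
    (hF : ∀ t ∈ T, SemiInv ψ ρ (d t) (e t) (F t)) :
    SemiInv ψ ρ (∑ t ∈ T, d t) (∑ t ∈ T, e t) (fun u => ∏ t ∈ T, F t u) := by
  classical
  induction T using Finset.induction_on with
  | empty => simpa using one
  | insert a T ha ih =>
    simp only [Finset.sum_insert ha, Finset.prod_insert ha]
    exact mul hρ (hF a (Finset.mem_insert_self a T))
      (ih fun t ht => hF t (Finset.mem_insert_of_mem ht))

lemma pow_val {j : Fin 3} (hF : SemiInv ψ ρ d (Pi.single j 1) F) (a : ZMod 2) :
    SemiInv ψ ρ (d * a.val) (Pi.single j a) (fun u => F u ^ a.val) := by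
  have h01 : ∀ a : ZMod 2, a = 0 ∨ a = 1 := by decide
  obtain rfl | rfl := h01 a
  · simpa using one
  · simpa [ZMod.val_one] using hF

/-- Semi-invariants of trivial weight are invariant functions, so they agree at two points that
the invariants of degree at most seven do not separate. -/
lemma eq_of_agree (hρ : IsPauliRep ρ) (h2 : (2 : K) ≠ 0) {v w : Fin n → K}
    (hvw : ∀ f ∈ polyInvariantsLE ψ 7, MvPolynomial.eval v f = MvPolynomial.eval w f)
    (hF : SemiInv ψ ρ d 0 F) (hd : d ≤ 7) : F v = F w := by
  have := hρ.finite
  refine eq_of_invariant (hρ.card_ne_zero h2) hvw (hF.isPolyFun.mono hd) fun g u => ?_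
  rw [hF.weight, pauliChar_zero, one_mul]

end SemiInv

lemma isPolyFun_mul_coord (φ φ' : (Fin n → K) →ₗ[K] (Fin 2 → K)) (j k : Fin 2) :
    IsPolyFun 2 (fun u => φ u j * φ' u k) :=
  (IsPolyFun.linear (LinearMap.proj j ∘ₗ φ)).mul (IsPolyFun.linear (LinearMap.proj k ∘ₗ φ'))

lemma isPolyFun_pauliForm (φ φ' : (Fin n → K) →ₗ[K] (Fin 2 → K)) (j : Fin 3) :
    IsPolyFun 2 (fun u => pauliForm j (φ u) (φ' u)) := by
  fin_cases j
  · exact (isPolyFun_mul_coord φ φ' 0 0).add (isPolyFun_mul_coord φ φ' 1 1)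
  · exact (isPolyFun_mul_coord φ φ' 0 0).sub (isPolyFun_mul_coord φ φ' 1 1)
  · exact (isPolyFun_mul_coord φ φ' 0 1).add (isPolyFun_mul_coord φ φ' 1 0)

namespace Equivariant

variable {φ φ' : (Fin n → K) →ₗ[K] (Fin 2 → K)}

lemma semiInv_form (hρ : IsPauliRep ρ) (hφ : Equivariant ψ ρ φ) (hφ' : Equivariant ψ ρ φ')
    (j : Fin 3) : SemiInv ψ ρ 2 (Pi.single j 1) (fun u => pauliForm j (φ u) (φ' u)) :=
  ⟨isPolyFun_pauliForm φ φ' j, fun g u => by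
    simp only [hφ g u, hφ' g u, (hρ.isPauli g).form_mulVec, pauliChar_single]⟩

lemma semiInv_form_detTwist (hρ : IsPauliRep ρ) (hφ : Equivariant ψ ρ φ)
    (hφ' : Equivariant ψ (detTwist ρ) φ') (j : Fin 3) :
    SemiInv ψ ρ 2 (Pi.single j 1 + 1) (fun u => pauliForm j (φ u) (φ' u)) :=
  ⟨isPolyFun_pauliForm φ φ' j, fun g u => by
    have hsmul (s : K) (a b : Fin 2 → K) : pauliForm j a (s • b) = s * pauliForm j a b := by
      fin_cases j <;> simp [pauliForm] <;> ring
    simp only [hφ g u, hφ' g u, detTwist_apply, Matrix.smul_mulVec, hsmul,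
      (hρ.isPauli g).form_mulVec, (hρ.isPauli g).char_add, pauliChar_single,
      (hρ.isPauli g).char_one]
    ring⟩

lemma semiInv_detForm_detTwist (hρ : IsPauliRep ρ) (hφ : Equivariant ψ ρ φ)
    (hφ' : Equivariant ψ (detTwist ρ) φ') :
    SemiInv ψ ρ 2 0 (fun u => detForm (φ u) (φ' u)) :=
  ⟨(isPolyFun_mul_coord φ φ' 0 1).sub (isPolyFun_mul_coord φ φ' 1 0), fun g u => by
    have hsmul (s : K) (a b : Fin 2 → K) : detForm a (s • b) = s * detForm a b := by
      simp [detForm]; ring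
    simp only [hφ g u, hφ' g u, detTwist_apply, Matrix.smul_mulVec, hsmul, detForm_mulVec,
      pauliChar_zero]
    rw [← mul_assoc, (hρ.isPauli g).det_mul_self]⟩

end Equivariant

lemma SemiInv.of_linear {l : (Fin n → K) →ₗ[K] K} {e : Fin 3 → ZMod 2}
    (hl : ∀ g u, l ((ψ g : Matrix (Fin n) (Fin n) K).mulVec u) = pauliChar e (ρ g) * l u) :
    SemiInv ψ ρ 1 e l := ⟨IsPolyFun.linear l, hl⟩

/-- The linear map `u ↦ ∑ g, (g⁻¹ u)_j σ(g)`. It is equivariant when `σ` is an orbit map of a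
representation. -/
noncomputable def averageMap [Fintype G] (ψ : G →* GL (Fin n) K) {M : Type*} [AddCommGroup M]
    [Module K M] (j : Fin n) (σ : G → M) : (Fin n → K) →ₗ[K] M :=
  ∑ g, (LinearMap.toSpanSingleton K M (σ g)) ∘ₗ (LinearMap.proj j) ∘ₗ
    (ψ g⁻¹ : Matrix (Fin n) (Fin n) K).mulVecLin

lemma averageMap_apply [Fintype G] {M : Type*} [AddCommGroup M] [Module K M] (j : Fin n)
    (σ : G → M) (u : Fin n → K) : averageMap ψ j σ u =
      ∑ g, ((ψ g⁻¹ : Matrix (Fin n) (Fin n) K).mulVec u) j • σ g := by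
  simp only [averageMap, LinearMap.sum_apply, LinearMap.comp_apply,
    LinearMap.toSpanSingleton_apply, LinearMap.proj_apply, Matrix.mulVecLin_apply]

lemma averageMap_mulVec [Fintype G] {M : Type*} [AddCommGroup M] [Module K M] (j : Fin n)
    (σ : G → M) (h : G) (u : Fin n → K) :
    averageMap ψ j σ ((ψ h : Matrix (Fin n) (Fin n) K).mulVec u) =
      averageMap ψ j (fun g => σ (h * g)) u := by
  rw [averageMap_apply, averageMap_apply]
  refine (Fintype.sum_equiv (Equiv.mulLeft h) _ _ fun g => ?_).symm
  rw [Equiv.coe_mulLeft, Matrix.mulVec_mulVec, ← Units.val_mul, ← map_mul]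
  simp

/-- Complete reducibility of the representation `ψ`, in dual form: its points are separated by
linear maps to the irreducible representations of `G`, which are the eight characters
`pauliChar e`, `ρ` and `detTwist ρ`. -/
lemma eq_of_equivariant (hρ : IsPauliRep ρ) (h2 : (2 : K) ≠ 0) {v w : Fin n → K}
    (hl : ∀ (e : Fin 3 → ZMod 2) (l : (Fin n → K) →ₗ[K] K),
      (∀ g u, l ((ψ g : Matrix (Fin n) (Fin n) K).mulVec u) = pauliChar e (ρ g) * l u) →
      l v = l w)
    (h₁ : ∀ φ, Equivariant ψ ρ φ → φ v = φ w)
    (h₂ : ∀ φ, Equivariant ψ (detTwist ρ) φ → φ v = φ w) : v = w := by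
  classical
  have := hρ.finite
  have := Fintype.ofFinite G
  have hav (τ : G →* Matrix (Fin 2) (Fin 2) K) (a : Fin 2 → K) (j : Fin n) :
      Equivariant ψ τ (averageMap ψ j fun g => (τ g).mulVec a) := fun g u => by
    rw [averageMap_mulVec, averageMap_apply, averageMap_apply, Matrix.mulVec_sum]
    simp only [map_mul, Matrix.mulVec_smul, Matrix.mulVec_mulVec]
  have hchar (e : Fin 3 → ZMod 2) (j : Fin n) (h : G) (u : Fin n → K) :
      averageMap ψ j (fun g => pauliChar e (ρ g)) ((ψ h : Matrix (Fin n) (Fin n) K).mulVec u) =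
        pauliChar e (ρ h) * averageMap ψ j (fun g => pauliChar e (ρ g)) u := by
    rw [averageMap_mulVec, averageMap_apply, averageMap_apply, Finset.mul_sum]
    refine Finset.sum_congr rfl fun g _ => ?_
    rw [map_mul, (hρ.isPauli h).char_mul (hρ.isPauli g), smul_eq_mul, smul_eq_mul]
    ring
  -- The coordinate `u j`, times sixteen, expanded along the regular character.
  have key (u : Fin n → K) (j : Fin n) :
      ∑ e, averageMap ψ j (fun g => pauliChar e (ρ g)) u +
        2 * ∑ k, averageMap ψ j (fun g => (ρ g).mulVec (Pi.single k 1)) u k +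
        2 * ∑ k, averageMap ψ j (fun g => (detTwist ρ g).mulVec (Pi.single k 1)) u k =
      16 * u j := by
    have htr (τ : G →* Matrix (Fin 2) (Fin 2) K) :
        ∑ k, averageMap ψ j (fun g => (τ g).mulVec (Pi.single k 1)) u k =
          ∑ g, ((ψ g⁻¹ : Matrix (Fin n) (Fin n) K).mulVec u) j * (τ g).trace := by
      simp only [averageMap_apply, Finset.sum_apply, Pi.smul_apply, smul_eq_mul,
        Matrix.mulVec_single_one, Matrix.col_apply, Matrix.trace, Matrix.diag_apply, Finset.mul_sum]
      exact Finset.sum_comm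
    rw [htr, htr]
    simp only [averageMap_apply, smul_eq_mul]
    rw [Finset.sum_comm, Finset.mul_sum, Finset.mul_sum, ← Finset.sum_add_distrib,
      ← Finset.sum_add_distrib, Finset.sum_eq_single 1]
    · have := regular_char_one (K := K)
      rw [Matrix.det_one, one_mul] at this
      simp only [← Finset.mul_sum, map_one, inv_one, Units.val_one, Matrix.one_mulVec]
      linear_combination u j * this
    · intro g _ hg
      have := (hρ.isPauli g).regular_char fun h => hg (hρ.inj (h.trans (map_one ρ).symm))
      simp only [← Finset.mul_sum, detTwist_apply, Matrix.trace_smul, smul_eq_mul]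
      linear_combination ((ψ g⁻¹ : Matrix (Fin n) (Fin n) K).mulVec u) j * this
    · simp
  have h16 : (16 : K) ≠ 0 := by
    rw [show (16 : K) = 2 ^ 4 by norm_num]; exact pow_ne_zero _ h2
  ext j
  refine mul_left_cancel₀ h16 ?_
  rw [← key v j, ← key w j]
  simp only [hl _ _ (hchar _ j), h₁ _ (hav ρ _ j), h₂ _ (hav (detTwist ρ) _ j)]

end SemiInvariants

/-! ### Separation by invariants of degree at most seven -/

section UpperBound

variable {K G : Type*} [Field K] [Group G] {n : ℕ} {ψ : G →* GL (Fin n) K}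
  {ρ : G →* Matrix (Fin 2) (Fin 2) K} {v w : Fin n → K}

/-- Multiplying a semi-invariant by values of the quadratic forms `pauliForm j` at an equivariant
map turns it into an invariant; where these values are not zero, they can be cancelled again. -/
lemma SemiInv.eq_of_form_ne_zero (hρ : IsPauliRep ρ) (h2 : (2 : K) ≠ 0)
    (hvw : ∀ f ∈ polyInvariantsLE ψ 7, MvPolynomial.eval v f = MvPolynomial.eval w f)
    {φ : (Fin n → K) →ₗ[K] (Fin 2 → K)} (hφ : Equivariant ψ ρ φ) (hp : φ v = φ w)
    {d : ℕ} {e : Fin 3 → ZMod 2} {F : (Fin n → K) → K} (hF : SemiInv ψ ρ d e F)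
    (hd : d + 2 * ((e 0).val + (e 1).val + (e 2).val) ≤ 7)
    (hne : ∀ j, e j ≠ 0 → pauliForm j (φ v) (φ v) ≠ 0) : F v = F w := by
  have hQ := SemiInv.prod hρ Finset.univ fun j _ =>
    (hφ.semiInv_form hρ hφ j).pow_val (e j)
  rw [Finset.univ_sum_single] at hQ
  have hadd : e + e = 0 := by ext j; exact CharTwo.add_self_eq_zero _
  have hFQ := hF.mul hρ hQ
  rw [hadd] at hFQ
  have := hFQ.eq_of_agree hρ h2 hvw (by rw [Fin.sum_univ_three]; omega)
  simp only [← hp] at this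
  refine mul_right_cancel₀ (Finset.prod_ne_zero_iff.2 fun j _ => ?_) this
  by_cases h : e j = 0
  · simp [h]
  · exact pow_ne_zero _ (hne j h)

lemma zmod_two_val_le (a : ZMod 2) : a.val ≤ 1 := Nat.le_of_lt_succ a.val_lt

lemma eq_of_forms_ne_zero (hρ : IsPauliRep ρ) (h2 : (2 : K) ≠ 0)
    (hvw : ∀ f ∈ polyInvariantsLE ψ 7, MvPolynomial.eval v f = MvPolynomial.eval w f)
    {φ : (Fin n → K) →ₗ[K] (Fin 2 → K)} (hφ : Equivariant ψ ρ φ) (hp : φ v = φ w)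
    (hne : ∀ j, pauliForm j (φ v) (φ v) ≠ 0) : v = w := by
  have h0 : φ v 0 ≠ 0 := fun h => hne 2 (by simp [pauliForm, h])
  have h1 : φ v 1 ≠ 0 := fun h => hne 2 (by simp [pauliForm, h])
  have hne' (e : Fin 3 → ZMod 2) (j : Fin 3) : e j ≠ 0 → pauliForm j (φ v) (φ v) ≠ 0 :=
    fun _ => hne j
  refine eq_of_equivariant (ψ := ψ) hρ h2 (fun e l hl => ?_) (fun φ' hφ' => ?_) (fun φ' hφ' => ?_)
  · refine (SemiInv.of_linear hl).eq_of_form_ne_zero hρ h2 hvw hφ hp ?_ (hne' _)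
    have := zmod_two_val_le (e 0)
    have := zmod_two_val_le (e 1)
    have := zmod_two_val_le (e 2)
    omega
  · have e0 := (hφ.semiInv_form hρ hφ' 0).eq_of_form_ne_zero hρ h2 hvw hφ hp (by decide) (hne' _)
    have e1 := (hφ.semiInv_form hρ hφ' 1).eq_of_form_ne_zero hρ h2 hvw hφ hp (by decide) (hne' _)
    simp only [pauliForm, Matrix.cons_val, ← hp] at e0 e1
    refine funext (Fin.forall_fin_two.2 ⟨?_, ?_⟩)
    · exact mul_left_cancel₀ (mul_ne_zero h2 h0) (by linear_combination e0 + e1)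
    · exact mul_left_cancel₀ (mul_ne_zero h2 h1) (by linear_combination e0 - e1)
  · have e0 := (hφ.semiInv_form_detTwist hρ hφ' 2).eq_of_form_ne_zero hρ h2 hvw hφ hp
      (by decide) (hne' _)
    have e1 := (hφ.semiInv_detForm_detTwist hρ hφ').eq_of_agree hρ h2 hvw (by decide)
    simp only [pauliForm, detForm, Matrix.cons_val, ← hp] at e0 e1
    refine funext (Fin.forall_fin_two.2 ⟨?_, ?_⟩)
    · exact mul_left_cancel₀ (mul_ne_zero h2 h1) (by linear_combination e0 - e1)
    · exact mul_left_cancel₀ (mul_ne_zero h2 h0) (by linear_combination e0 + e1)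

lemma eval_mulVec_of_mem {f : MvPolynomial (Fin n) K} (hf : f ∈ polyInvariants ψ) (g : G)
    (u : Fin n → K) : MvPolynomial.eval ((ψ g : Matrix (Fin n) (Fin n) K).mulVec u) f =
      MvPolynomial.eval u f := by
  have h := eval_coordAct ψ g⁻¹ f u
  rw [mem_polyInvariants_iff.1 hf, inv_inv] at h
  exact h.symm

/-- The case where an equivariant map sends `v` and `w` to the same point of the first axis. This
point is fixed by the reflection `s = diag(1, -1)`. The components of `v` and `w` fixed by `s` are
equal, since the invariants below determine them. The products of two components negated by `s`
also agree, so that `w = v` or `w = s v`. -/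
lemma exists_mulVec_eq_of_axis (hρ : IsPauliRep ρ) (h2 : (2 : K) ≠ 0)
    (hvw : ∀ f ∈ polyInvariantsLE ψ 7, MvPolynomial.eval v f = MvPolynomial.eval w f)
    {φ : (Fin n → K) →ₗ[K] (Fin 2 → K)} (hφ : Equivariant ψ ρ φ) (hp : φ v = φ w)
    (h0 : φ v 0 ≠ 0) (h1 : φ v 1 = 0) :
    ∃ g, (ψ g : Matrix (Fin n) (Fin n) K).mulVec v = w := by
  have hdec : ∀ a : ZMod 2, a ≠ 1 → a = 0 := by decide
  have hne (u : Fin n → K) (hu : φ u = φ w) (e : Fin 3 → ZMod 2) (he : e 2 = 0) (j : Fin 3)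
      (hj : e j ≠ 0) : pauliForm j (φ u) (φ u) ≠ 0 := by
    rw [hu, ← hp]
    fin_cases j
    · simp [pauliForm, h0, h1]
    · simp [pauliForm, h0, h1]
    · exact absurd he hj
  -- The semi-invariants negated by the reflection; the bounds on the degree and the weight keep
  -- the invariants made from products of two of them within degree seven.
  let Neg (F : (Fin n → K) → K) : Prop :=
    ∃ d e, SemiInv ψ ρ d e F ∧ e 2 = 1 ∧ d ≤ 2 ∧ (e 0 = 0 ∨ d ≤ 1)
  have hprod (F F' : (Fin n → K) → K) (hF : Neg F) (hF' : Neg F') : F v * F' v = F w * F' w := by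
    obtain ⟨d, e, hF, he, hd, hde⟩ := hF
    obtain ⟨d', e', hF', he', hd', hde'⟩ := hF'
    have h2e : (e + e') 2 = 0 := by rw [Pi.add_apply, he, he']; rfl
    refine (hF.mul hρ hF').eq_of_form_ne_zero hρ h2 hvw hφ hp ?_ (hne v hp _ h2e)
    have a0 := zmod_two_val_le ((e + e') 0)
    have a1 := zmod_two_val_le ((e + e') 1)
    rw [h2e, ZMod.val_zero]
    by_cases hdd : d + d' ≤ 3
    · omega
    · have : (e + e') 0 = 0 := by
        rw [Pi.add_apply, hde.resolve_right (by omega), hde'.resolve_right (by omega), add_zero]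
      rw [this, ZMod.val_zero]
      omega
  have hfin (u : Fin n → K) (hu : φ u = φ w)
      (huw : ∀ f ∈ polyInvariantsLE ψ 7, MvPolynomial.eval u f = MvPolynomial.eval w f)
      (hneg : ∀ F, Neg F → F u = F w) : u = w := by
    have hu0 : φ w 0 ≠ 0 := hp ▸ h0
    have hu1 : φ w 1 = 0 := hp ▸ h1
    refine eq_of_equivariant (ψ := ψ) hρ h2 (fun e l hl => ?_) (fun φ' hφ' => ?_) (fun φ' hφ' => ?_)
    · by_cases he : e 2 = 1
      · exact hneg l ⟨1, e, SemiInv.of_linear hl, he, by simp, Or.inr le_rfl⟩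
      · have he := hdec _ he
        refine (SemiInv.of_linear hl).eq_of_form_ne_zero hρ h2 huw hφ hu ?_ (hne u hu _ he)
        have := zmod_two_val_le (e 0)
        have := zmod_two_val_le (e 1)
        rw [he, ZMod.val_zero]
        omega
    · have e0 := (hφ.semiInv_form hρ hφ' 0).eq_of_form_ne_zero hρ h2 huw hφ hu (by decide)
        (hne u hu _ (by decide))
      have e1 := hneg _ ⟨2, _, hφ.semiInv_form hρ hφ' 2, by decide, le_rfl, Or.inl (by decide)⟩
      simp only [pauliForm, Matrix.cons_val, hu, hu1, zero_mul, add_zero] at e0 e1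
      ext j; fin_cases j
      · exact mul_left_cancel₀ hu0 e0
      · exact mul_left_cancel₀ hu0 e1
    · have e0 := hneg _ ⟨2, _, hφ.semiInv_form_detTwist hρ hφ' 0, by decide, le_rfl,
        Or.inl (by decide)⟩
      have e1 := (hφ.semiInv_detForm_detTwist hρ hφ').eq_of_agree hρ h2 huw (by decide)
      simp only [pauliForm, detForm, Matrix.cons_val, hu, hu1, zero_mul, add_zero, sub_zero]
        at e0 e1
      ext j; fin_cases j
      · exact mul_left_cancel₀ hu0 e0
      · exact mul_left_cancel₀ hu0 e1
  by_cases hall : ∀ F, Neg F → F v = F w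
  · exact ⟨1, by simpa using hfin v hp hvw hall⟩
  · push Not at hall
    obtain ⟨F, hF, hFvw⟩ := hall
    obtain ⟨s, hs⟩ := hρ.surj !![1, 0; 0, -1] ⟨1, by simp, Or.inr (Or.inl rfl)⟩
    have hFw : F w = -F v := by
      rcases mul_self_eq_mul_self_iff.1 (hprod F F hF hF) with h | h
      · exact absurd h hFvw
      · rw [h, neg_neg]
    have hFv : F v ≠ 0 := fun h => hFvw (by rw [hFw, h, neg_zero])
    refine ⟨s, hfin _ ?_ (fun f hf => by rw [eval_mulVec_of_mem hf.1, hvw f hf]) fun F' hF' => ?_⟩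
    · rw [hφ, hs, ← hp]
      ext j; fin_cases j <;> simp [Matrix.mulVec, dotProduct, h1]
    · have h := hprod F F' hF hF'
      rw [hFw] at h
      have hF'w : F' w = -F' v := mul_left_cancel₀ hFv (by linear_combination h)
      obtain ⟨d, e, hF', he, -⟩ := hF'
      rw [hF'.weight, hs, hF'w, pauliChar, Fin.prod_univ_three, he]
      simp [pauliSign, ZMod.val_one]

/-- The matrix `!![1, t⁻¹; 1, -t⁻¹]`, where `t ^ 4 = 1`, normalizes the group of Pauli matrices. It
moves the line through `(1, t)`, which is fixed by a reflection, to the first axis. Here `s * t` is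
the inverse of `t`, and `r` is the inverse of `2`. -/
lemma isPauli_conj {t s r : K} (hr : 2 * r = 1) (hs : s * s = 1) (ht : t * t = s)
    (hs' : s = 1 ∨ s = -1) {N : Matrix (Fin 2) (Fin 2) K} (hN : IsPauli N) :
    IsPauli (!![1, s * t; 1, -(s * t)] * N * !![r, r; r * t, -(r * t)]) ∧
      IsPauli (!![r, r; r * t, -(r * t)] * N * !![1, s * t; 1, -(s * t)]) := by
  have ht4 : t ^ 4 = 1 := by rw [← hs, ← ht]; ring
  have hr' : r + r = 1 := by linear_combination hr
  obtain ⟨z, hz, hN⟩ := hN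
  have hzt : (z * t) ^ 4 = 1 := by rw [mul_pow, hz, ht4, one_mul]
  have hzt' : (-(z * t)) ^ 4 = 1 := by rw [← hzt]; ring
  have hst : (s * z * t) ^ 4 = 1 := by
    rw [mul_pow, mul_pow, hz, ht4]; linear_combination (s * s + 1) * hs
  have of (A : Matrix (Fin 2) (Fin 2) K) (a b c d : K) (h : A = !![a, b; c, d])
      (hA : ∃ y : K, y ^ 4 = 1 ∧ ((a = y ∧ b = 0 ∧ c = 0 ∧ (d = y ∨ d = -y)) ∨
        (a = 0 ∧ b = y ∧ (c = y ∨ c = -y) ∧ d = 0))) : IsPauli A := by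
    obtain ⟨y, hy, ⟨rfl, rfl, rfl, rfl | rfl⟩ | ⟨rfl, rfl, rfl | rfl, rfl⟩⟩ := hA <;>
      exact ⟨_, hy, by simp [h]⟩
  -- In each case below the proposed root of unity is the nonzero entry of the first row.
  refine ⟨of _ _ _ _ _ (Matrix.eta_fin_two _) ?_, of _ _ _ _ _ (Matrix.eta_fin_two _) ?_⟩
  · rcases hN with rfl | rfl | rfl | rfl <;> simp [Matrix.mul_apply, Fin.sum_univ_two]
    · refine ⟨z, hz, Or.inl ?_⟩
      grind
    · refine ⟨z, hz, Or.inr ?_⟩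
      grind
    · rcases hs' with rfl | rfl
      · refine ⟨z * t, hzt, Or.inl ?_⟩
        grind
      · refine ⟨-(z * t), hzt', Or.inr ?_⟩
        grind
    · rcases hs' with rfl | rfl
      · refine ⟨-(z * t), hzt', Or.inr ?_⟩
        grind
      · refine ⟨z * t, hzt, Or.inl ?_⟩
        grind
  · rcases hN with rfl | rfl | rfl | rfl <;> simp [Matrix.mul_apply, Fin.sum_univ_two]
    · refine ⟨z, hz, Or.inl ?_⟩
      grind
    · refine ⟨s * z * t, hst, Or.inr ?_⟩
      grind
    · refine ⟨z, hz, Or.inl ?_⟩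
      grind
    · refine ⟨-(s * z * t), by rw [← hst]; ring, Or.inr ?_⟩
      grind

lemma isPauli_swap_conj {N : Matrix (Fin 2) (Fin 2) K} (hN : IsPauli N) :
    IsPauli (!![0, 1; 1, 0] * N * !![0, 1; 1, 0]) := by
  obtain ⟨z, hz, rfl | rfl | rfl | rfl⟩ := hN
  · exact ⟨z, hz, by simp⟩
  · exact ⟨-z, by rw [← hz]; ring, by simp⟩
  · exact ⟨z, hz, by simp⟩
  · exact ⟨-z, by rw [← hz]; ring, by simp⟩

lemma exists_mulVec_eq_of_conj (hρ : IsPauliRep ρ) (h2 : (2 : K) ≠ 0)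
    (hvw : ∀ f ∈ polyInvariantsLE ψ 7, MvPolynomial.eval v f = MvPolynomial.eval w f)
    {φ : (Fin n → K) →ₗ[K] (Fin 2 → K)} (hφ : Equivariant ψ ρ φ) (hp : φ v = φ w)
    {M M' : Matrix (Fin 2) (Fin 2) K} (h : M * M' = 1)
    (hM : ∀ N, IsPauli N → IsPauli (M * N * M') ∧ IsPauli (M' * N * M))
    (h0 : M.mulVec (φ v) 0 ≠ 0) (h1 : M.mulVec (φ v) 1 = 0) :
    ∃ g, (ψ g : Matrix (Fin n) (Fin n) K).mulVec v = w := by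
  have h' : M' * M = 1 := mul_eq_one_comm.1 h
  refine exists_mulVec_eq_of_axis (hρ.conjRep h hM) h2 hvw (φ := M.mulVecLin ∘ₗ φ)
    (fun g u => ?_) (by simp [hp]) (by simpa using h0) (by simpa using h1)
  rw [conjRep_apply, LinearMap.comp_apply, LinearMap.comp_apply, hφ, Matrix.mulVecLin_apply,
    Matrix.mulVecLin_apply, Matrix.mulVec_mulVec, Matrix.mulVec_mulVec, mul_assoc, mul_assoc, h',
    mul_one]

lemma exists_mulVec_eq_of_ne_zero (hρ : IsPauliRep ρ) (h2 : (2 : K) ≠ 0) {i : K}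
    (hi : i ^ 2 = -1)
    (hvw : ∀ f ∈ polyInvariantsLE ψ 7, MvPolynomial.eval v f = MvPolynomial.eval w f)
    {φ : (Fin n → K) →ₗ[K] (Fin 2 → K)} (hφ : Equivariant ψ ρ φ) (hp : φ v = φ w)
    (h0 : φ v ≠ 0) : ∃ g, (ψ g : Matrix (Fin n) (Fin n) K).mulVec v = w := by
  have hline (s t : K) (hs : s * s = 1) (ht : t * t = s) (hs' : s = 1 ∨ s = -1)
      (h : φ v 1 = t * φ v 0) : ∃ g, (ψ g : Matrix (Fin n) (Fin n) K).mulVec v = w := by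
    have hr : (2 : K) * 2⁻¹ = 1 := mul_inv_cancel₀ h2
    have h00 : φ v 0 ≠ 0 := fun h' =>
      h0 (funext (Fin.forall_fin_two.2 ⟨h', by rw [h, h', mul_zero]; rfl⟩))
    refine exists_mulVec_eq_of_conj hρ h2 hvw hφ hp (M := !![1, s * t; 1, -(s * t)])
      (M' := !![2⁻¹, 2⁻¹; 2⁻¹ * t, -(2⁻¹ * t)]) ?_
      (fun N hN => isPauli_conj hr hs ht hs' hN) ?_ ?_
    · rw [Matrix.mul_fin_two, Matrix.one_fin_two]
      congr 3 <;> [skip; congr 1; congr 1] <;> grind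
    · have : (!![1, s * t; 1, -(s * t)] : Matrix (Fin 2) (Fin 2) K).mulVec (φ v) 0 =
          2 * φ v 0 := by
        simp only [Matrix.mulVec, dotProduct, Fin.sum_univ_two, Matrix.of_apply, Matrix.cons_val, h]
        linear_combination φ v 0 * s * ht + φ v 0 * hs
      rw [this]
      exact mul_ne_zero h2 h00
    · simp only [Matrix.mulVec, dotProduct, Fin.sum_univ_two, Matrix.of_apply, Matrix.cons_val, h]
      linear_combination -φ v 0 * s * ht - φ v 0 * hs
  by_cases hne : ∀ j, pauliForm j (φ v) (φ v) ≠ 0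
  · exact ⟨1, by simpa using eq_of_forms_ne_zero hρ h2 hvw hφ hp hne⟩
  · push Not at hne
    obtain ⟨j, hj⟩ := hne
    fin_cases j <;> simp only [pauliForm, Matrix.cons_val, Fin.zero_eta, Fin.mk_one,
      Fin.reduceFinMk] at hj
    · have : (φ v 1 - i * φ v 0) * (φ v 1 + i * φ v 0) = 0 := by
        linear_combination hj - φ v 0 ^ 2 * hi
      rcases mul_eq_zero.1 this with h | h
      · exact hline (-1) i (by ring) (by rw [← hi]; ring) (Or.inr rfl) (sub_eq_zero.1 h)
      · exact hline (-1) (-i) (by ring) (by rw [← hi]; ring) (Or.inr rfl)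
          (by linear_combination h)
    · rcases mul_self_eq_mul_self_iff.1 (sub_eq_zero.1 hj).symm with h | h
      · exact hline 1 1 (by ring) (by ring) (Or.inl rfl) (by linear_combination h)
      · exact hline 1 (-1) (by ring) (by ring) (Or.inl rfl) (by linear_combination h)
    · have : φ v 0 * φ v 1 = 0 := mul_left_cancel₀ h2 (by linear_combination hj)
      rcases mul_eq_zero.1 this with h | h
      · have h1 : φ v 1 ≠ 0 := fun h' => h0 (funext (Fin.forall_fin_two.2 ⟨h, h'⟩))
        refine exists_mulVec_eq_of_conj hρ h2 hvw hφ hp (M := !![0, 1; 1, 0])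
          (M' := !![0, 1; 1, 0]) (by simp [Matrix.one_fin_two])
          (fun N hN => ⟨isPauli_swap_conj hN, isPauli_swap_conj hN⟩) ?_ ?_
        · simpa [Matrix.mulVec, dotProduct] using h1
        · simpa [Matrix.mulVec, dotProduct] using h
      · have h1 : φ v 0 ≠ 0 := fun h' => h0 (funext (Fin.forall_fin_two.2 ⟨h', h⟩))
        exact exists_mulVec_eq_of_axis hρ h2 hvw hφ hp h1 h

/-- The invariants of degree four show that an equivariant map sends `v` and `w` to the same orbit
of Pauli matrices. -/
lemma exists_mulVec_image_eq (hρ : IsPauliRep ρ) (h2 : (2 : K) ≠ 0)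
    (hvw : ∀ f ∈ polyInvariantsLE ψ 7, MvPolynomial.eval v f = MvPolynomial.eval w f)
    {φ : (Fin n → K) →ₗ[K] (Fin 2 → K)} (hφ : Equivariant ψ ρ φ) :
    ∃ g, (ρ g).mulVec (φ v) = φ w := by
  have key (j : Fin 3) := by
    have h := (hφ.semiInv_form hρ hφ j).mul hρ (hφ.semiInv_form hρ hφ j)
    have hadd (e : Fin 3 → ZMod 2) : e + e = 0 := by ext; exact CharTwo.add_self_eq_zero _
    rw [hadd] at h
    exact h.eq_of_agree hρ h2 hvw (by decide)
  obtain ⟨N, hN, h⟩ := exists_isPauli_mulVec h2 (key 0) (key 2)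
  obtain ⟨g, rfl⟩ := hρ.surj N hN
  exact ⟨g, h⟩

/-- The case where some two-dimensional component of `v` does not vanish. -/
lemma exists_mulVec_eq_of_equivariant (hρ : IsPauliRep ρ) (h2 : (2 : K) ≠ 0) {i : K}
    (hi : i ^ 2 = -1)
    (hvw : ∀ f ∈ polyInvariantsLE ψ 7, MvPolynomial.eval v f = MvPolynomial.eval w f)
    {φ : (Fin n → K) →ₗ[K] (Fin 2 → K)} (hφ : Equivariant ψ ρ φ)
    (h0 : φ v ≠ 0) : ∃ g, (ψ g : Matrix (Fin n) (Fin n) K).mulVec v = w := by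
  obtain ⟨g, hg⟩ := exists_mulVec_image_eq hρ h2 hvw hφ
  have hg' : φ ((ψ g : Matrix (Fin n) (Fin n) K).mulVec v) = φ w := by rw [hφ, hg]
  have hw : φ w ≠ 0 := fun h => h0 (by
    have : (ρ g⁻¹).mulVec ((ρ g).mulVec (φ v)) = φ v := by
      rw [Matrix.mulVec_mulVec, ← map_mul, inv_mul_cancel, map_one, Matrix.one_mulVec]
    rw [← this, hg, h, Matrix.mulVec_zero])
  obtain ⟨g', h'⟩ := exists_mulVec_eq_of_ne_zero hρ h2 hi
    (fun f hf => by rw [eval_mulVec_of_mem hf.1, hvw f hf]) hφ hg' (hg' ▸ hw)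
  exact ⟨g' * g, by rw [map_mul, Units.val_mul, ← Matrix.mulVec_mulVec, h']⟩

/-- A function on a subset `E` of `𝔽₂ ^ 3` extends to a linear form as soon as it respects the
linear relations of length at most four: `E` contains a basis of its span, and a relation between
another element of `E` and this basis has at most four terms. -/
lemma exists_linearMap_eqOn (E : Set (Fin 3 → ZMod 2)) (r : (Fin 3 → ZMod 2) → ZMod 2)
    (h : ∀ T : Finset (Fin 3 → ZMod 2), (T : Set (Fin 3 → ZMod 2)) ⊆ E → T.card ≤ 3 →
      ∀ e ∈ E, e = ∑ t ∈ T, t → r e = ∑ t ∈ T, r t) :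
    ∃ f : (Fin 3 → ZMod 2) →ₗ[ZMod 2] ZMod 2, ∀ e ∈ E, f e = r e := by
  classical
  obtain ⟨b, hbE, hspan, hli⟩ := exists_linearIndependent (ZMod 2) E
  let B := Module.Basis.extend hli
  let f : (Fin 3 → ZMod 2) →ₗ[ZMod 2] ZMod 2 := B.constr ℕ fun x => r x
  have hf : ∀ x ∈ b, f x = r x := fun x hx => by
    have h1 := B.constr_basis ℕ (fun x => r x) ⟨x, LinearIndepOn.subset_extend (v := id) hli _ hx⟩
    rwa [show B ⟨x, _⟩ = x from Module.Basis.extend_apply_self hli _] at h1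
  refine ⟨f, fun e he => ?_⟩
  have hmem : e ∈ Submodule.span (ZMod 2) (b.toFinset : Set (Fin 3 → ZMod 2)) := by
    rw [Set.coe_toFinset, hspan]; exact Submodule.subset_span he
  obtain ⟨c, -, hc⟩ := Submodule.mem_span_finset.1 hmem
  have hsum : e = ∑ t ∈ b.toFinset with c t = 1, t := by
    rw [← hc, Finset.sum_filter]
    refine Finset.sum_congr rfl fun t _ => ?_
    have h01 : ∀ a : ZMod 2, a = 0 ∨ a = 1 := by decide
    rcases h01 (c t) with h | h <;> simp [h]
  have hTb : ∀ t ∈ b.toFinset.filter (c · = 1), t ∈ b := fun t ht => by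
    simpa using (Finset.mem_filter.1 ht).1
  have hcard : (b.toFinset.filter (c · = 1)).card ≤ 3 := by
    refine (Finset.card_filter_le _ _).trans ?_
    rw [Set.toFinset_card]
    simpa using hli.fintype_card_le_finrank
  rw [h _ (fun t ht => hbE (hTb t ht)) hcard e he hsum]
  conv_lhs => rw [hsum, map_sum]
  exact Finset.sum_congr rfl fun t ht => hf t (hTb t ht)

/-- The case where all two-dimensional components of `v` vanish, so that only the abelianization
`(ℤ/2) ^ 3` of `G` matters. -/
lemma exists_mulVec_eq_of_equivariant_eq_zero (hρ : IsPauliRep ρ) (h2 : (2 : K) ≠ 0) {i : K}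
    (hi : i ^ 2 = -1)
    (hvw : ∀ f ∈ polyInvariantsLE ψ 7, MvPolynomial.eval v f = MvPolynomial.eval w f)
    (h₁ : ∀ φ, Equivariant ψ ρ φ → φ v = 0) (h₂ : ∀ φ, Equivariant ψ (detTwist ρ) φ → φ v = 0) :
    ∃ g, (ψ g : Matrix (Fin n) (Fin n) K).mulVec v = w := by
  classical
  have hw {τ : G →* Matrix (Fin 2) (Fin 2) K} (hτ : IsPauliRep τ) {φ} (hφ : Equivariant ψ τ φ)
      (hv : φ v = 0) : φ w = 0 := by
    obtain ⟨g, hg⟩ := exists_mulVec_image_eq hτ h2 hvw hφ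
    rw [← hg, hv, Matrix.mulVec_zero]
  -- The isomorphism from `𝔽₂` to the group of signs.
  let sgn (a : ZMod 2) : K := (-1) ^ a.val
  have h01 : ∀ a : ZMod 2, a = 0 ∨ a = 1 := by decide
  have hsgn0 : sgn 0 = 1 := by simp [sgn]
  have hsgn1 : sgn 1 = -1 := by simp [sgn, ZMod.val_one]
  have h11 : (1 : ZMod 2) + 1 = 0 := rfl
  have hsgn_add (a b : ZMod 2) : sgn (a + b) = sgn a * sgn b := by
    rcases h01 a with rfl | rfl <;> rcases h01 b with rfl | rfl <;> simp [hsgn0, hsgn1, h11]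
  have hsgn_sum {ι : Type} (T : Finset ι) (a : ι → ZMod 2) :
      sgn (∑ t ∈ T, a t) = ∏ t ∈ T, sgn (a t) := by
    induction T using Finset.induction_on with
    | empty => simp [hsgn0]
    | insert t T ht ih => rw [Finset.sum_insert ht, Finset.prod_insert ht, hsgn_add, ih]
  have hsgn_inj (a : ZMod 2) (ha : sgn a = 1) : a = 0 := by
    rcases h01 a with h | h
    · exact h
    · rw [h, hsgn1] at ha
      exact absurd (by linear_combination -ha : (2 : K) = 0) h2
  let IsWt (e : Fin 3 → ZMod 2) (l : (Fin n → K) →ₗ[K] K) : Prop :=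
    ∀ g u, l ((ψ g : Matrix (Fin n) (Fin n) K).mulVec u) = pauliChar e (ρ g) * l u
  have hadd (e : Fin 3 → ZMod 2) : e + e = 0 := by ext; exact CharTwo.add_self_eq_zero _
  have hmul {e l l'} (hl : IsWt e l) (hl' : IsWt e l') : l v * l' v = l w * l' w := by
    have h := (SemiInv.of_linear hl).mul hρ (SemiInv.of_linear hl')
    rw [hadd] at h
    exact h.eq_of_agree hρ h2 hvw (by decide)
  -- `w` differs from `v` by a sign `sgn (r e)` on the part of weight `e`.
  have hex (e : Fin 3 → ZMod 2) : ∃ a, ∀ l, IsWt e l → l w = sgn a * l v := by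
    by_cases he : ∃ l, IsWt e l ∧ l v ≠ 0
    · obtain ⟨l, hl, hlv⟩ := he
      have ha : ∃ a, l w = sgn a * l v := by
        rcases mul_self_eq_mul_self_iff.1 (hmul hl hl) with h | h
        · exact ⟨0, by rw [hsgn0, h, one_mul]⟩
        · exact ⟨1, by rw [hsgn1, h]; ring⟩
      obtain ⟨a, ha⟩ := ha
      have haa : sgn a * sgn a = 1 := by rw [← hsgn_add, CharTwo.add_self_eq_zero, hsgn0]
      refine ⟨a, fun l' hl' => mul_left_cancel₀ hlv ?_⟩
      have := hmul hl hl'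
      rw [ha] at this
      linear_combination -sgn a * this - l v * l' w * haa
    · push Not at he
      refine ⟨0, fun l hl => ?_⟩
      have := hmul hl hl
      rw [he l hl, mul_zero] at this
      rw [he l hl, mul_zero, mul_self_eq_zero.1 this.symm]
  choose r hr using hex
  obtain ⟨f, hf⟩ := exists_linearMap_eqOn {e | ∃ l, IsWt e l ∧ l v ≠ 0} r
    fun T hT hcard e he hsum => by
      obtain ⟨l, hl, hlv⟩ := he
      have hT' (t : Fin 3 → ZMod 2) : ∃ l, t ∈ T → IsWt t l ∧ l v ≠ 0 := by
        by_cases ht : t ∈ T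
        · obtain ⟨l, hl⟩ := hT ht
          exact ⟨l, fun _ => hl⟩
        · exact ⟨0, fun h => absurd h ht⟩
      choose L hL using hT'
      have h := (SemiInv.of_linear hl).mul hρ
        (SemiInv.prod hρ T fun t ht => SemiInv.of_linear (hL t ht).1)
      rw [← hsum, hadd] at h
      have h' := h.eq_of_agree hρ h2 hvw (by simp; omega)
      have hw' : ∏ t ∈ T, L t w = sgn (∑ t ∈ T, r t) * ∏ t ∈ T, L t v := by
        rw [hsgn_sum, ← Finset.prod_mul_distrib]
        exact Finset.prod_congr rfl fun t ht => hr t _ (hL t ht).1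
      have hne : l v * ∏ t ∈ T, L t v ≠ 0 :=
        mul_ne_zero hlv (Finset.prod_ne_zero_iff.2 fun t ht => (hL t ht).2)
      rw [hw', hr e l hl] at h'
      have h1 : sgn (r e + ∑ t ∈ T, r t) = 1 := by
        rw [hsgn_add]
        refine mul_right_cancel₀ hne ?_
        linear_combination -h'
      exact CharTwo.add_eq_zero.1 (hsgn_inj _ h1)
  obtain ⟨N, hN, hNs⟩ := exists_isPauli_sign hi (fun j => sgn (f (Pi.single j 1))) fun j => by
    rcases h01 (f (Pi.single j 1)) with h | h <;> simp [h, hsgn0, hsgn1]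
  obtain ⟨g, rfl⟩ := hρ.surj N hN
  have hchar (e : Fin 3 → ZMod 2) : pauliChar e (ρ g) = sgn (f e) := by
    have he : f e = ∑ j, e j * f (Pi.single j 1) := by
      conv_lhs => rw [← Finset.univ_sum_single e, map_sum]
      refine Finset.sum_congr rfl fun j _ => ?_
      rw [← smul_eq_mul, ← map_smul]
      congr 1
      ext k
      simp [Pi.single_apply]
    rw [he, hsgn_sum, pauliChar]
    refine Finset.prod_congr rfl fun j _ => ?_
    rw [hNs]
    rcases h01 (e j) with h | h <;> simp [h, hsgn0, ZMod.val_one]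
  refine ⟨g, eq_of_equivariant (ψ := ψ) hρ h2 (fun e l hl => ?_) (fun φ hφ => ?_)
    (fun φ hφ => ?_)⟩
  · rw [hl, hchar, hr e l hl]
    by_cases hlv : l v = 0
    · rw [hlv, mul_zero, mul_zero]
    · rw [hf e ⟨l, hl, hlv⟩]
  · rw [hφ, h₁ φ hφ, hw hρ hφ (h₁ φ hφ), Matrix.mulVec_zero]
  · rw [hφ, h₂ φ hφ, hw hρ.detTwist hφ (h₂ φ hφ), Matrix.mulVec_zero]

lemma isSeparatingSet_seven (hρ : IsPauliRep ρ) (h2 : (2 : K) ≠ 0) {i : K} (hi : i ^ 2 = -1)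
    (ψ : G →* GL (Fin n) K) : IsSeparatingSet ψ (polyInvariantsLE ψ 7) := by
  refine ⟨fun f hf => hf.1, fun v w hvw => ?_⟩
  by_cases h₁ : ∀ φ, Equivariant ψ ρ φ → φ v = 0
  · by_cases h₂ : ∀ φ, Equivariant ψ (detTwist ρ) φ → φ v = 0
    · exact exists_mulVec_eq_of_equivariant_eq_zero hρ h2 hi hvw h₁ h₂
    · push Not at h₂
      obtain ⟨φ, hφ, h0⟩ := h₂
      exact exists_mulVec_eq_of_equivariant hρ.detTwist h2 hi hvw hφ h0
  · push Not at h₁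
    obtain ⟨φ, hφ, h0⟩ := h₁
    exact exists_mulVec_eq_of_equivariant hρ h2 hi hvw hφ h0

end UpperBound

/-! ### The Pauli group -/

section PauliGroup

variable {K : Type*} [Field K] {i : K}

lemma IsPauli.mul {M N : Matrix (Fin 2) (Fin 2) K} (hM : IsPauli M) (hN : IsPauli N) :
    IsPauli (M * N) := by
  obtain ⟨y, hy, hM⟩ := hM
  obtain ⟨z, hz, hN⟩ := hN
  have h : (y * z) ^ 4 = 1 := by rw [mul_pow, hy, hz, one_mul]
  have h' : (-(y * z)) ^ 4 = 1 := by rw [← h]; ring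
  rcases hM with rfl | rfl | rfl | rfl <;> rcases hN with rfl | rfl | rfl | rfl <;>
    first
      | (refine ⟨y * z, h, ?_⟩; simp; done)
      | (refine ⟨-(y * z), h', ?_⟩; simp)

lemma exists_eq_pow_of_pow_four_eq_one (hi : i ^ 2 = -1) {z : K} (hz : z ^ 4 = 1) :
    ∃ k : ℕ, z = i ^ k := by
  have h : ((z - 1) * (z + 1)) * ((z - i) * (z + i)) = 0 := by
    linear_combination hz - (z ^ 2 - 1) * hi
  rcases mul_eq_zero.1 h with h | h <;> rcases mul_eq_zero.1 h with h | h
  · exact ⟨0, by linear_combination h⟩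
  · exact ⟨2, by linear_combination h - hi⟩
  · exact ⟨1, by linear_combination h⟩
  · exact ⟨3, by linear_combination h - i * hi⟩

/-- The elements of the Pauli group are exactly the Pauli matrices. -/
lemma mem_pauliGroup_iff (hi : i ^ 2 = -1) (g : GL (Fin 2) K) :
    g ∈ pauliGroup i ↔ IsPauli (g : Matrix (Fin 2) (Fin 2) K) := by
  have hi4 : i ^ 4 = 1 := by linear_combination (i ^ 2 - 1) * hi
  constructor
  · intro hg
    induction hg using Subgroup.closure_induction with
    | mem g hg =>
      rcases hg with h | h | h <;> rw [h]
      · exact ⟨1, by simp, by simp⟩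
      · exact ⟨-i, by rw [← hi4]; ring, by simp⟩
      · exact ⟨1, by simp, by simp⟩
    | one => exact ⟨1, by simp, by simp [Matrix.one_fin_two]⟩
    | mul g h _ _ hg hh => exact hg.mul hh
    | inv g _ hg =>
      have h : (g⁻¹ : GL (Fin 2) K) = g ^ 3 := by
        rw [inv_eq_iff_mul_eq_one, ← pow_succ']
        exact Units.ext (by simpa using hg.pow_four)
      rw [h, Units.val_pow_eq_pow_val, pow_succ, pow_two]
      exact (hg.mul hg).mul hg
  · rintro ⟨z, hz, hg⟩
    obtain ⟨k, rfl⟩ := exists_eq_pow_of_pow_four_eq_one hi hz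
    have hii : i * i = -1 := by rw [← hi, pow_two]
    let X : GL (Fin 2) K := ⟨!![0, 1; 1, 0], !![0, 1; 1, 0], by simp [Matrix.one_fin_two],
      by simp [Matrix.one_fin_two]⟩
    let Y : GL (Fin 2) K := ⟨!![0, -i; i, 0], !![0, -i; i, 0], by simp [Matrix.one_fin_two, hii],
      by simp [Matrix.one_fin_two, hii]⟩
    let Z : GL (Fin 2) K := ⟨!![1, 0; 0, -1], !![1, 0; 0, -1], by simp [Matrix.one_fin_two],
      by simp [Matrix.one_fin_two]⟩
    have hX : X ∈ pauliGroup i := Subgroup.subset_closure (Or.inl rfl)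
    have hY : Y ∈ pauliGroup i := Subgroup.subset_closure (Or.inr (Or.inl rfl))
    have hZ : Z ∈ pauliGroup i := Subgroup.subset_closure (Or.inr (Or.inr rfl))
    -- `X Y Z` is the scalar matrix `i`.
    have hXYZ : ((X * Y * Z : GL (Fin 2) K) : Matrix (Fin 2) (Fin 2) K) = i • 1 := by
      simp [X, Y, Z, Matrix.one_fin_two]
    have key (A : GL (Fin 2) K) (hA : A ∈ pauliGroup i)
        (h : (g : Matrix (Fin 2) (Fin 2) K) = i ^ k • (A : Matrix (Fin 2) (Fin 2) K)) :
        g ∈ pauliGroup i := by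
      have : g = (X * Y * Z) ^ k * A := Units.ext (by
        rw [h, Units.val_mul, Units.val_pow_eq_pow_val, hXYZ, smul_pow, one_pow, smul_mul_assoc,
          one_mul])
      rw [this]
      exact mul_mem (pow_mem (mul_mem (mul_mem hX hY) hZ) k) hA
    rcases hg with hg | hg | hg | hg
    · exact key 1 (one_mem _) (by rw [hg]; simp [Matrix.one_fin_two])
    · exact key Z hZ (by rw [hg]; simp [Z])
    · exact key X hX (by rw [hg]; simp [X])
    · exact key (Z * X) (mul_mem hZ hX) (by rw [hg]; simp [Z, X])

/-- The natural two-dimensional representation of the Pauli group. -/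
def pauliRep (i : K) : pauliGroup i →* Matrix (Fin 2) (Fin 2) K :=
  (Units.coeHom _).comp (pauliGroup i).subtype

lemma isPauliRep_pauliRep (hi : i ^ 2 = -1) : IsPauliRep (pauliRep i) where
  isPauli g := (mem_pauliGroup_iff hi _).1 g.2
  surj N hN := by
    let g : GL (Fin 2) K := ⟨N, N ^ 3, by rw [← pow_succ', hN.pow_four],
      by rw [← pow_succ, hN.pow_four]⟩
    exact ⟨⟨g, (mem_pauliGroup_iff hi g).2 hN⟩, rfl⟩
  inj g h hgh := Subtype.ext (Units.ext hgh)

end PauliGroup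

/-! ### A representation of the Pauli group for which degree six does not suffice -/

section LowerBound

variable {K : Type*} [Field K] {i : K}

lemma coeff_aeval_C_mul_X {σ : Type*} (c : σ → K) (f : MvPolynomial σ K)
    (m : σ →₀ ℕ) :
    MvPolynomial.coeff m (MvPolynomial.aeval
      (fun j => MvPolynomial.C (c j) * (MvPolynomial.X j : MvPolynomial σ K)) f) =
      (m.prod fun j k => c j ^ k) * MvPolynomial.coeff m f := by
  classical
  induction f using MvPolynomial.induction_on' with
  | add p q hp hq => rw [map_add, MvPolynomial.coeff_add, hp, hq, MvPolynomial.coeff_add, mul_add]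
  | monomial l a =>
    have h : MvPolynomial.aeval (fun j => MvPolynomial.C (c j) *
        (MvPolynomial.X j : MvPolynomial σ K)) (MvPolynomial.monomial l a) =
        MvPolynomial.monomial l ((l.prod fun j k => c j ^ k) * a) := by
      rw [MvPolynomial.aeval_monomial, MvPolynomial.monomial_eq, MvPolynomial.algebraMap_eq]
      simp only [mul_pow, Finsupp.prod, Finset.prod_mul_distrib, map_mul, map_prod, map_pow]
      ring
    rw [h, MvPolynomial.coeff_monomial, MvPolynomial.coeff_monomial]
    split_ifs with hl
    · rw [hl]
    · rw [mul_zero]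

/-- The direct sum of the natural representation of the Pauli group and its determinant
character. -/
noncomputable def pauliDetRep (i : K) : pauliGroup i →* GL (Fin 3) K :=
  MonoidHom.toHomUnits
    { toFun := fun g => !![pauliRep i g 0 0, pauliRep i g 0 1, 0;
        pauliRep i g 1 0, pauliRep i g 1 1, 0; 0, 0, (pauliRep i g).det]
      map_one' := by
        ext j k; fin_cases j <;> fin_cases k <;> simp
      map_mul' := fun g h => by
        rw [map_mul, Matrix.det_mul]
        ext j k; fin_cases j <;> fin_cases k <;>
          simp [Matrix.mul_apply, Fin.sum_univ_two, Fin.sum_univ_three] }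

lemma pauliDetRep_apply (i : K) (g : pauliGroup i) :
    (pauliDetRep i g : Matrix (Fin 3) (Fin 3) K) = !![pauliRep i g 0 0, pauliRep i g 0 1, 0;
      pauliRep i g 1 0, pauliRep i g 1 1, 0; 0, 0, (pauliRep i g).det] := rfl

lemma aeval_eq_of_mem (hi : i ^ 2 = -1) {f : MvPolynomial (Fin 3) K}
    (hf : f ∈ polyInvariants (pauliDetRep i)) {N : Matrix (Fin 2) (Fin 2) K} (hN : IsPauli N)
    {p : Fin 3 → MvPolynomial (Fin 3) K}
    (h0 : p 0 = MvPolynomial.C (N 0 0) * MvPolynomial.X 0 +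
      MvPolynomial.C (N 0 1) * MvPolynomial.X 1)
    (h1 : p 1 = MvPolynomial.C (N 1 0) * MvPolynomial.X 0 +
      MvPolynomial.C (N 1 1) * MvPolynomial.X 1)
    (h2 : p 2 = MvPolynomial.C N.det * MvPolynomial.X 2) :
    MvPolynomial.aeval p f = f := by
  obtain ⟨g, rfl⟩ := (isPauliRep_pauliRep hi).surj N hN
  have h := mem_polyInvariants_iff.1 hf g⁻¹
  rw [coordAct, inv_inv, pauliDetRep_apply] at h
  convert h using 2
  congr 1
  ext1 j
  fin_cases j <;> simp [Fin.sum_univ_three, h0, h1, h2]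

/-- The part of an invariant that is odd in the third variable `t` is a multiple of `t` times the
product `x y (x ^ 4 - y ^ 4)` of the linear forms of the six reflections, so an invariant of degree
at most six has no such part. -/
lemma even_of_mem_support (hi : i ^ 2 = -1) (h2 : (2 : K) ≠ 0) {f : MvPolynomial (Fin 3) K}
    (hf : f ∈ polyInvariantsLE (pauliDetRep i) 6) {m : Fin 3 →₀ ℕ} (hm : m ∈ f.support) :
    Even (m 2) := by
  by_contra hodd
  rw [Nat.not_even_iff_odd] at hodd
  have hi4 : i ^ 4 = 1 := by linear_combination (i ^ 2 - 1) * hi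
  have h1 : (-1 : K) ≠ 1 := fun h => h2 (by linear_combination -h)
  have hc : MvPolynomial.coeff m f ≠ 0 := MvPolynomial.mem_support_iff.1 hm
  have hdeg : m 0 + m 1 + m 2 ≤ 6 := by
    have := (MvPolynomial.le_totalDegree hm).trans hf.2
    rwa [Finsupp.sum_fintype _ _ (fun _ => rfl), Fin.sum_univ_three] at this
  -- A diagonal Pauli matrix must fix each monomial of `f`.
  have hdiag (a b : K) (hN : IsPauli !![a, 0; 0, b]) :
      a ^ m 0 * b ^ m 1 * (a * b) ^ m 2 = 1 := by
    have h := aeval_eq_of_mem hi hf.1 hN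
      (p := fun j => MvPolynomial.C (![a, b, a * b] j) * MvPolynomial.X j)
      (by simp) (by simp) (by simp [Matrix.det_fin_two])
    have h := congrArg (MvPolynomial.coeff m) h
    rw [coeff_aeval_C_mul_X, Finsupp.prod_fintype _ _ (fun _ => pow_zero _),
      Fin.prod_univ_three] at h
    exact mul_right_cancel₀ hc (h.trans (one_mul _).symm)
  have hm0 : Odd (m 0) := by
    have h := hdiag (-1) 1 ⟨-1, by ring, by simp⟩
    rw [one_pow, mul_one, mul_one, hodd.neg_one_pow] at h
    by_contra h'
    rw [Nat.not_odd_iff_even] at h'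
    rw [h'.neg_one_pow, one_mul] at h
    exact h1 h
  have hm1 : Odd (m 1) := by
    have h := hdiag 1 (-1) ⟨1, by ring, by simp⟩
    rw [one_pow, one_mul, one_mul, hodd.neg_one_pow] at h
    by_contra h'
    rw [Nat.not_odd_iff_even] at h'
    rw [h'.neg_one_pow, one_mul] at h
    exact h1 h
  have hmi : i ^ (m 0 + m 1) = -1 := by
    have h := hdiag i i ⟨i, hi4, by simp⟩
    rw [← pow_two, hi, hodd.neg_one_pow, ← pow_add] at h
    linear_combination -h
  have h4 : m 0 + m 1 ≠ 4 := fun h => by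
    rw [h, hi4] at hmi
    exact h1 hmi.symm
  -- Only a monomial `x y t ^ k` is left, and exchanging `x` and `y` changes its sign.
  have h01 : m 0 = m 1 := by
    obtain ⟨a, ha⟩ := hm0
    obtain ⟨b, hb⟩ := hm1
    obtain ⟨c, hc⟩ := hodd
    omega
  let σ : Equiv.Perm (Fin 3) := Equiv.swap 0 1
  let q := MvPolynomial.aeval (fun j => MvPolynomial.C (![1, 1, -1] j) *
    (MvPolynomial.X j : MvPolynomial (Fin 3) K)) f
  have hq : MvPolynomial.rename σ q = f := by
    have hcomp : MvPolynomial.rename σ q = MvPolynomial.aeval (fun j =>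
        MvPolynomial.rename σ (MvPolynomial.C (![1, 1, -1] j) *
        (MvPolynomial.X j : MvPolynomial (Fin 3) K))) f := by
      rw [← MvPolynomial.comp_aeval_apply]
    rw [hcomp]
    refine aeval_eq_of_mem hi hf.1 (N := !![0, 1; 1, 0]) ⟨1, by simp, by simp⟩ ?_ ?_ ?_
    · simp [σ]
    · simp [σ]
    · have : σ 2 = 2 := by decide
      simp [this, Matrix.det_fin_two]
  have hmσ : m.mapDomain σ = m := by
    ext j
    rw [Finsupp.mapDomain_equiv_apply, Equiv.symm_swap]
    fin_cases j
    · simp [h01]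
    · simp [h01]
    · rw [Equiv.swap_apply_of_ne_of_ne] <;> decide
  have h := MvPolynomial.coeff_rename_mapDomain σ σ.injective q m
  rw [hmσ, hq, coeff_aeval_C_mul_X, Finsupp.prod_fintype _ _ (fun _ => pow_zero _),
    Fin.prod_univ_three] at h
  simp [hodd.neg_one_pow] at h
  exact hc (mul_left_cancel₀ h2 (by linear_combination h))

/-- The points `(1, y, 1)` and `(1, y, -1)` lie in different orbits when `(1, y)` has trivial
stabilizer, but invariants of degree at most six agree on them. -/
lemma not_isSeparatingSet_six (hi : i ^ 2 = -1) (h2 : (2 : K) ≠ 0) {y : K} (hy : y ≠ 0)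
    (hy4 : y ^ 4 ≠ 1) {d : ℕ} (hd : d ≤ 6) :
    ¬ IsSeparatingSet (pauliDetRep i) (polyInvariantsLE (pauliDetRep i) d) := by
  rintro ⟨-, hsep⟩
  obtain ⟨g, hg⟩ := hsep ![1, y, 1] ![1, y, -1] fun f hf => by
    rw [MvPolynomial.eval_eq', MvPolynomial.eval_eq']
    refine Finset.sum_congr rfl fun m hm => ?_
    have := even_of_mem_support hi h2 ⟨hf.1, hf.2.trans hd⟩ hm
    simp [Fin.prod_univ_three, this.neg_one_pow]
  rw [pauliDetRep_apply] at hg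
  have e0 := congrFun hg 0
  have e1 := congrFun hg 1
  have e2 := congrFun hg 2
  simp only [Matrix.mulVec, dotProduct, Fin.sum_univ_three, Matrix.of_apply, Matrix.cons_val,
    mul_one, zero_mul, add_zero, zero_add] at e0 e1 e2
  obtain ⟨z, hz, h | h | h | h⟩ := (isPauliRep_pauliRep hi).isPauli g <;>
    simp only [h, Matrix.of_apply, Matrix.cons_val, Matrix.det_fin_two, mul_zero,
      zero_mul, add_zero, zero_add] at e0 e1 e2
  · exact h2 (by rw [e0] at e2; linear_combination e2)
  · rw [e0] at e1
    exact mul_ne_zero h2 hy (by linear_combination -e1)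
  · refine hy4 ?_
    rw [e1] at e0
    linear_combination (y * y + 1) * e0
  · refine hy4 ?_
    have : y = -z := e1.symm
    rw [this, ← hz]; ring

lemma exists_ne_zero_pow_four_ne_one (hi : i ^ 2 = -1) (h2 : (2 : K) ≠ 0) (hK : Nat.card K ≠ 5) :
    ∃ y : K, y ≠ 0 ∧ y ^ 4 ≠ 1 := by
  classical
  by_contra! hall
  apply hK
  have h11 : (1 : K) ≠ -1 := fun h => h2 (by linear_combination h)
  have hi0 : i ≠ 0 := by rintro rfl; simp at hi
  have hi1 : i ≠ 1 := by rintro rfl; exact h11 (by linear_combination hi)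
  have hi1' : i ≠ -1 := by rintro rfl; exact h11 (by linear_combination hi)
  have hii : i ≠ -i := fun h => mul_ne_zero h2 hi0 (by linear_combination h)
  have huniv : (Set.univ : Set K) = (({0, 1, -1, i, -i} : Finset K) : Set K) := by
    refine (Set.eq_univ_of_forall fun y => ?_).symm
    by_cases hy : y = 0
    · simp [hy]
    · have h : ((y - 1) * (y + 1)) * ((y - i) * (y + i)) = 0 := by
        linear_combination hall y hy - (y ^ 2 - 1) * hi
      rcases mul_eq_zero.1 h with h | h <;> rcases mul_eq_zero.1 h with h | h
      · simp [sub_eq_zero.1 h]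
      · simp [eq_neg_of_add_eq_zero_left h]
      · simp [sub_eq_zero.1 h]
      · simp [eq_neg_of_add_eq_zero_left h]
  rw [← Set.ncard_univ, huniv, Set.ncard_coe_finset]
  have h1i : (1 : K) ≠ -i := fun h => hi1' (by linear_combination h)
  rw [Finset.card_insert_of_notMem, Finset.card_insert_of_notMem, Finset.card_insert_of_notMem,
    Finset.card_pair hii]
  · simp [hi1'.symm, hi1.symm]
  · simp [h11, hi1.symm, h1i]
  · simp [hi0, hi0.symm]

end LowerBound

theorem theorem4p4 {K : Type*} [Field K] (i : K) (hi : orderOf i = 4)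
    (hK : Nat.card K ≠ 5) :
    betaSep K (pauliGroup i) = 7 := by
  have hi4 : i ^ 4 = 1 := hi ▸ pow_orderOf_eq_one i
  have hi21 : i ^ 2 ≠ 1 := pow_ne_one_of_lt_orderOf (by norm_num) (by rw [hi]; norm_num)
  have hi2 : i ^ 2 = -1 := by
    rcases mul_self_eq_one_iff.1 (show i ^ 2 * i ^ 2 = 1 by rw [← hi4]; ring) with h | h
    · exact absurd h hi21
    · exact h
  have h2 : (2 : K) ≠ 0 := fun h => hi21 (by linear_combination hi2 - h)
  refine le_antisymm (iSup₂_le fun n ψ => ?_) ?_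
  · exact iInf₂_le 7 (isSeparatingSet_seven (isPauliRep_pauliRep hi2) h2 hi2 ψ)
  · obtain ⟨y, hy, hy4⟩ := exists_ne_zero_pow_four_ne_one hi2 h2 hK
    refine le_iSup₂_of_le 3 (pauliDetRep i) (le_iInf₂ fun d hd => ?_)
    by_contra hlt
    have hd6 : d ≤ 6 := by
      have : d < 7 := by exact_mod_cast not_le.1 hlt
      omega
    exact not_isSeparatingSet_six hi2 h2 hy hy4 hd6 hd
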